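/- Let $\mathbf{V\#L}$ be the two-sorted theory (numbers, and strings, i.e. finite sets of numbers) over the vocabulary $0,1,+,\cdot,|\cdot|,\in,\le,=$ with the following axioms: the 2-BASIC axioms of Cook and Nguyen; comprehension $\exists X\,(|X|\le y\wedge\forall x<y\,(X(x)\leftrightarrow\varphi(x)))$ for every $\Sigma^B_0$ formula $\varphi$ in which $X$ is not free; string multiplication $\forall X,Y\,\exists Z\,(Z=X\cdot Y)$, where strings are read as binary numbers; and matrix powering, which says that for every square matrix $X$ over $\mathbb Z$ (coded by a string, with entries in binary) and every number $n$ there is a string $Y$ with $Y=X^n$. In $\mathbf{V\#L}$ the Pfaffian of a skew symmetric integer matrix $A$ of order $2N$ is defined by the PB recursion, as follows. Let $J$ denote the block diagonal matrix with blocks $\begin{pmatrix}0&1\\-1&0\end{pmatrix}$, of the order that the context requires. For $N\ge 1$ write $$A=\begin{pmatrix}0&a&R\\-a&0&-S^{t}\\-R^{t}&S&M\end{pmatrix},$$ where $M$ has order $2N-2$, and let $P_A$ be the $(N+1)\times N$ lower triangular Toeplitz matrix with first column $1,\ a,\ RJS,\ RJ(MJ)S,\ \dots,\ RJ(MJ)^{N-2}S$.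 The Pfaffian coefficients $\bar p_A=(p_N,\dots,p_0)$ are given by $\bar p_A=P_A\,\bar p_M$, starting from the sequence $(1)$ for the empty matrix, so that $\bar p_A=(1,a)$ when $N=1$. Then $\mathrm{pf}(A)=p_0$. **Theorem.** $\mathbf{V\#L}$ proves that for every number $n$, if $I$ is the $2n\times 2n$ identity matrix, then $$\mathrm{pf}\begin{pmatrix}0&I\\-I&0\end{pmatrix}=(-1)^n .$$ That is, $\mathbf{V\#L}$ proves that this $4n\times 4n$ matrix exists, that its Pfaffian (as computed by the PB recursion) exists, and that every value of the Pfaffian equals $(-1)^n$. -/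

import Mathlib

universe u v

namespace VSharpL

/-! ## Two-sorted first-order logic over the vocabulary `0, 1, +, ·, |·|, ∈, ≤, =₁, =₂` -/

/-- Terms of the number sort. Number variables and string variables are both named by natural
numbers. The only string terms of the vocabulary are the string variables. -/
inductive NTerm : Type
  | var (x : ℕ) : NTerm
  | zero : NTerm
  | one : NTerm
  | add (s t : NTerm) : NTerm
  | mul (s t : NTerm) : NTerm
  | len (X : ℕ) : NTerm

instance : Zero NTerm := ⟨NTerm.zero⟩
instance : One NTerm := ⟨NTerm.one⟩
instance : Add NTerm := ⟨NTerm.add⟩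
instance : Mul NTerm := ⟨NTerm.mul⟩

/-- The number variable `x` occurs in a term. -/
def NTerm.Occurs (x : ℕ) : NTerm → Prop
  | .var y => x = y
  | .zero => False
  | .one => False
  | .add s t => s.Occurs x ∨ t.Occurs x
  | .mul s t => s.Occurs x ∨ t.Occurs x
  | .len _ => False

/-- The string variable `X` occurs in a term. -/
def NTerm.OccursStr (X : ℕ) : NTerm → Prop
  | .var _ => False
  | .zero => False
  | .one => False
  | .add s t => s.OccursStr X ∨ t.OccursStr X
  | .mul s t => s.OccursStr X ∨ t.OccursStr X
  | .len Y => X = Y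

/-- Two-sorted formulas; `mem t X` is the atom `t ∈ X`, also written `X(t)`. -/
inductive Formula : Type
  | eqN (s t : NTerm) : Formula
  | eqS (X Y : ℕ) : Formula
  | le (s t : NTerm) : Formula
  | mem (t : NTerm) (X : ℕ) : Formula
  | neg (φ : Formula) : Formula
  | and (φ ψ : Formula) : Formula
  | or (φ ψ : Formula) : Formula
  | allN (x : ℕ) (φ : Formula) : Formula
  | exN (x : ℕ) (φ : Formula) : Formula
  | allS (X : ℕ) (φ : Formula) : Formula
  | exS (X : ℕ) (φ : Formula) : Formula

/-- The string variable `X` occurs free in a formula. -/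
def Formula.FreeStr (X : ℕ) : Formula → Prop
  | .eqN s t => s.OccursStr X ∨ t.OccursStr X
  | .eqS Y Z => X = Y ∨ X = Z
  | .le s t => s.OccursStr X ∨ t.OccursStr X
  | .mem t Y => t.OccursStr X ∨ X = Y
  | .neg φ => φ.FreeStr X
  | .and φ ψ => φ.FreeStr X ∨ ψ.FreeStr X
  | .or φ ψ => φ.FreeStr X ∨ ψ.FreeStr X
  | .allN _ φ => φ.FreeStr X
  | .exN _ φ => φ.FreeStr X
  | .allS Y φ => X ≠ Y ∧ φ.FreeStr X
  | .exS Y φ => X ≠ Y ∧ φ.FreeStr X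

def Formula.imp (φ ψ : Formula) : Formula := .or (.neg φ) ψ
def Formula.iff (φ ψ : Formula) : Formula := .and (.imp φ ψ) (.imp ψ φ)
def Formula.xor (φ ψ : Formula) : Formula := .neg (.iff φ ψ)
def Formula.lt (s t : NTerm) : Formula := .and (.le s t) (.neg (.eqN s t))

infix:50 " ≐ " => Formula.eqN
infix:50 " ≼ " => Formula.le
infix:50 " ≺ " => Formula.lt
infixr:35 " ⋏ " => Formula.and
infixr:30 " ⋎ " => Formula.or
infixr:25 " ⇛ " => Formula.imp
infix:20 " ⟺ " => Formula.iff

/-- A two-sorted structure for the vocabulary; both equality symbols are interpreted by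
equality. -/
structure Model : Type (max (u + 1) (v + 1)) where
  Num : Type u
  Str : Type v
  str_nonempty : Nonempty Str
  zero : Num
  one : Num
  add : Num → Num → Num
  mul : Num → Num → Num
  len : Str → Num
  le : Num → Num → Prop
  mem : Num → Str → Prop

/-- The value of a term under an assignment `e` of the number and `E` of the string variables. -/
def NTerm.eval (M : Model.{u, v}) (e : ℕ → M.Num) (E : ℕ → M.Str) : NTerm → M.Num
  | .var x => e x
  | .zero => M.zero
  | .one => M.one
  | .add s t => M.add (s.eval M e E) (t.eval M e E)
  | .mul s t => M.mul (s.eval M e E) (t.eval M e E)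
  | .len X => M.len (E X)

/-- Tarski satisfaction. -/
def Formula.Sat (M : Model.{u, v}) : (ℕ → M.Num) → (ℕ → M.Str) → Formula → Prop
  | e, E, .eqN s t => s.eval M e E = t.eval M e E
  | _, E, .eqS X Y => E X = E Y
  | e, E, .le s t => M.le (s.eval M e E) (t.eval M e E)
  | e, E, .mem t X => M.mem (t.eval M e E) (E X)
  | e, E, .neg φ => ¬ φ.Sat M e E
  | e, E, .and φ ψ => φ.Sat M e E ∧ ψ.Sat M e E
  | e, E, .or φ ψ => φ.Sat M e E ∨ ψ.Sat M e E
  | e, E, .allN x φ => ∀ a : M.Num, φ.Sat M (Function.update e x a) E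
  | e, E, .exN x φ => ∃ a : M.Num, φ.Sat M (Function.update e x a) E
  | e, E, .allS X φ => ∀ A : M.Str, φ.Sat M e (Function.update E X A)
  | e, E, .exS X φ => ∃ A : M.Str, φ.Sat M e (Function.update E X A)

/-- A structure is a model of a set of axioms if the universal closure of each axiom holds. -/
def Model.Models (M : Model.{u, v}) (T : Set Formula) : Prop :=
  ∀ φ ∈ T, ∀ (e : ℕ → M.Num) (E : ℕ → M.Str), φ.Sat M e E

/-- `T ⊢ φ`. The theory with axioms `T` is the closure of `T` under logical consequence and
universal closure, and it proves its elements. -/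
def Proves (T : Set Formula) (φ : Formula) : Prop :=
  ∀ M : Model.{u, v}, M.Models T → M.Models {φ}

/-! ## The base theory: 2-BASIC and comprehension for bounded formulas -/

/-- `Σ₀ᴮ` formulas: no string quantifiers, and all number quantifiers bounded. -/
inductive IsSigmaB0 : Formula → Prop
  | eqN (s t : NTerm) : IsSigmaB0 (.eqN s t)
  | eqS (X Y : ℕ) : IsSigmaB0 (.eqS X Y)
  | le (s t : NTerm) : IsSigmaB0 (.le s t)
  | mem (t : NTerm) (X : ℕ) : IsSigmaB0 (.mem t X)
  | neg {φ : Formula} : IsSigmaB0 φ → IsSigmaB0 (.neg φ)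
  | and {φ ψ : Formula} : IsSigmaB0 φ → IsSigmaB0 ψ → IsSigmaB0 (.and φ ψ)
  | or {φ ψ : Formula} : IsSigmaB0 φ → IsSigmaB0 ψ → IsSigmaB0 (.or φ ψ)
  | ball {x : ℕ} {t : NTerm} {φ : Formula} : ¬ t.Occurs x → IsSigmaB0 φ →
      IsSigmaB0 (.allN x (.var x ≼ t ⇛ φ))
  | bex {x : ℕ} {t : NTerm} {φ : Formula} : ¬ t.Occurs x → IsSigmaB0 φ →
      IsSigmaB0 (.exN x (.var x ≼ t ⋏ φ))

/-- The axioms 2-BASIC, with `x = var 0`, `y = var 1` and string variables `X = 0`, `Y = 1`. -/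
def basic : Set Formula :=
  let x : NTerm := .var 0
  let y : NTerm := .var 1
  { .neg (x + 1 ≐ 0),
    x + 1 ≐ y + 1 ⇛ x ≐ y,
    x + 0 ≐ x,
    x + (y + 1) ≐ (x + y) + 1,
    x * 0 ≐ 0,
    x * (y + 1) ≐ (x * y) + x,
    x ≼ y ⋏ y ≼ x ⇛ x ≐ y,
    x ≼ x + y,
    0 ≼ x,
    x ≼ y ⋎ y ≼ x,
    x ≼ y ⟺ x ≺ y + 1,
    .neg (x ≐ 0) ⇛ .exN 1 (y ≼ x ⋏ y + 1 ≐ x),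
    .mem y 0 ⇛ y ≺ .len 0,
    y + 1 ≐ .len 0 ⇛ .mem y 0,
    .len 0 ≐ .len 1 ⋏ .allN 0 (x ≺ .len 0 ⇛ (.mem x 0 ⟺ .mem x 1)) ⇛ .eqS 0 1 }

/-- The comprehension axiom `∃ X ≤ y, ∀ x < y, (X(x) ↔ φ(x))`. -/
def compAxiom (φ : Formula) (x y X : ℕ) : Formula :=
  .exS X (.len X ≼ .var y ⋏
    .allN x (.var x ≺ .var y ⇛ (.mem (.var x) X ⟺ φ)))

def sigmaB0Comp : Set Formula :=
  {ψ | ∃ (φ : Formula) (x y X : ℕ), IsSigmaB0 φ ∧ x ≠ y ∧ ¬ φ.FreeStr X ∧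
    ψ = compAxiom φ x y X}

/-! ## Arithmetic and linear algebra inside the theory

The formulas below are built by functions that take terms and "bit predicates" as arguments.
Quantifiers are written `allNum 7 fun i => …`, where `7` is the name of the bound variable; the
names are chosen so that no argument contains a variable bound inside the function. -/

def allNum (x : ℕ) (f : NTerm → Formula) : Formula := .allN x (f (.var x))
def exNum (x : ℕ) (f : NTerm → Formula) : Formula := .exN x (f (.var x))
def allStr (X : ℕ) (f : ℕ → Formula) : Formula := .allS X (f X)
def exStr (X : ℕ) (f : ℕ → Formula) : Formula := .exS X (f X)

/-- A finite set of positions given by a membership formula: a string, or a row of an array. -/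
abbrev Bits : Type := NTerm → Formula

def bits (X : ℕ) : Bits := fun i => .mem i X

def eqBits (b c : Bits) : Formula := allNum 0 fun i => b i ⟺ c i
def emptyBits (b : Bits) : Formula := allNum 1 fun i => .neg (b i)

/-! ### Natural numbers in binary: `b` stands for `∑ 2 ^ i` over the positions `i` in `b` -/

/-- There is a carry into position `i` when adding `b` and `c`. -/
def carry (b c : Bits) (i : NTerm) : Formula :=
  exNum 2 fun k => k ≺ i ⋏ b k ⋏ c k ⋏ allNum 3 fun j => k ≺ j ⋏ j ≺ i ⇛ b j ⋎ c j

/-- `b + c = d`. -/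
def natAdd (b c d : Bits) : Formula :=
  allNum 4 fun i => d i ⟺ ((b i).xor (c i)).xor (carry b c i)

/-- `2 ^ s * b`. -/
def shift (s : NTerm) (b : Bits) : Bits := fun j => exNum 5 fun t => t + s ≐ j ⋏ b t

/-- The `l`-th row of the array `W`, where `pair` is the usual pairing function. -/
def pair (x y : NTerm) : NTerm := (x + y) * (x + y + 1) + (1 + 1) * y
def row (W : ℕ) (l : NTerm) : Bits := fun i => .mem (pair l i) W

/-- `b * c = d`: the array `W` lists the products `b * (c mod 2 ^ i)` for `i ≤ l`, where all
positions in `c` are below `l`. -/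
def natMul (b c d : Bits) : Formula :=
  exNum 6 fun l => (allNum 7 fun i => c i ⇛ i ≺ l) ⋏ exStr 0 fun W =>
    emptyBits (row W 0) ⋏
    (allNum 8 fun i => i ≺ l ⇛
      (c i ⇛ natAdd (row W i) (shift i b) (row W (i + 1))) ⋏
      (.neg (c i) ⇛ eqBits (row W (i + 1)) (row W i))) ⋏
    eqBits (row W l) d

/-! ### Integers: position `0` is the sign (present iff negative), the rest the magnitude -/

def sign (b : Bits) : Formula := b 0
def mag (b : Bits) : Bits := fun i => b (i + 1)

def nonzero (b : Bits) : Formula := exNum 9 fun i => mag b i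

/-- Zero is not negative, so every integer has exactly one code. -/
def isInt (b : Bits) : Formula := sign b ⇛ nonzero b

def isZero (b : Bits) : Formula := emptyBits b
def isOne (b : Bits) : Formula := allNum 10 fun i => b i ⟺ i ≐ 1
def isNegOne (b : Bits) : Formula := allNum 11 fun i => b i ⟺ (i ≐ 0 ⋎ i ≐ 1)

/-- `b + c = d` for integers. -/
def intAdd (b c d : Bits) : Formula :=
  isInt d ⋏
  ((((sign b ⟺ sign c) ⋏ (sign d ⟺ sign b) ⋏ natAdd (mag b) (mag c) (mag d))) ⋎
   ((sign b).xor (sign c) ⋏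
     (((sign d ⟺ sign b) ⋏ natAdd (mag c) (mag d) (mag b)) ⋎
      ((sign d ⟺ sign c) ⋏ natAdd (mag b) (mag d) (mag c)))))

/-- `b * c = d` for integers. -/
def intMul (b c d : Bits) : Formula :=
  isInt d ⋏ natMul (mag b) (mag c) (mag d) ⋏
    (nonzero d ⇛ (sign d ⟺ (sign b).xor (sign c)))

/-! ### Matrices, with rows and columns numbered from `0` -/

abbrev Mat : Type := NTerm → NTerm → Bits

/-- The two-dimensional array of integers coded by the string `X`. -/
def mat (X : ℕ) : Mat := fun a b i => .mem (pair (pair a b) i) X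

/-- The `k`-th entry of the sequence of two-dimensional arrays coded by the string `P`. -/
def mats (P : ℕ) (k : NTerm) : Mat := fun a b i => .mem (pair (pair (pair k a) b) i) P

/-- The block of `A` that starts in row `s` and column `t`. -/
def block (A : Mat) (s t : NTerm) : Mat := fun a b => A (s + a) (t + b)

/-- The entries of `A` in the range `p × q` are integers. -/
def isMat (p q : NTerm) (A : Mat) : Formula :=
  allNum 12 fun a => allNum 13 fun b => a ≺ p ⋏ b ≺ q ⇛ isInt (A a b)

def eqMat (p q : NTerm) (A B : Mat) : Formula :=
  allNum 14 fun a => allNum 15 fun b => a ≺ p ⋏ b ≺ q ⇛ eqBits (A a b) (B a b)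

/-- `A` is the identity matrix of order `m`. -/
def isId (m : NTerm) (A : Mat) : Formula :=
  allNum 16 fun a => allNum 17 fun b => a ≺ m ⋏ b ≺ m ⇛
    (a ≐ b ⇛ isOne (A a b)) ⋏ (.neg (a ≐ b) ⇛ isZero (A a b))

/-- `∑ l < q, A a l * B l b = d`; the array `T` lists the partial sums. -/
def dot (q : NTerm) (A B : Mat) (a b : NTerm) (d : Bits) : Formula :=
  exStr 1 fun T =>
    isZero (row T 0) ⋏
    (allNum 18 fun l => l ≺ q ⇛ exStr 2 fun V =>
      intMul (A a l) (B l b) (bits V) ⋏ intAdd (row T l) (bits V) (row T (l + 1))) ⋏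
    eqBits (row T q) d

/-- `A * B = C`, with `A` of size `p × q`, `B` of size `q × r` and `C` of size `p × r`. -/
def matMul (p q r : NTerm) (A B C : Mat) : Formula :=
  allNum 19 fun a => allNum 20 fun b => a ≺ p ⋏ b ≺ r ⇛ dot q A B a b (C a b)

/-- `A ^ n = B` for matrices of order `m`; the string `P` lists the powers of `A`. -/
def matPow (m : NTerm) (A : Mat) (n : NTerm) (B : Mat) : Formula :=
  exStr 3 fun P =>
    isId m (mats P 0) ⋏
    (allNum 21 fun k => k ≺ n ⇛ matMul m m m (mats P k) A (mats P (k + 1))) ⋏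
    eqMat m m (mats P n) B

/-! ## The theory `V#L` -/

/-- `∀ X Y, ∃ Z, Z = X * Y`. -/
def stringMultiplication : Formula :=
  allStr 10 fun X => allStr 11 fun Y => exStr 12 fun Z => natMul (bits X) (bits Y) (bits Z)

/-- For every square integer matrix `X` and every `n` there is `Y = X ^ n`. -/
def matrixPowering : Formula :=
  allNum 30 fun m => allNum 31 fun n => allStr 10 fun X =>
    isMat m m (mat X) ⇛ exStr 11 fun Y => matPow m (mat X) n (mat Y)

def theory : Set Formula :=
  basic ∪ sigmaB0Comp ∪ {stringMultiplication, matrixPowering}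

/-! ## The Pfaffian through the PB algorithm -/

/-- `A` is the matrix `J` of order `m` (`m` even): the block diagonal matrix with blocks
`(0, 1; -1, 0)`. -/
def isJ (m : NTerm) (A : Mat) : Formula :=
  let upper (a b : NTerm) : Formula := exNum 40 fun t => a ≐ t + t ⋏ b ≐ t + t + 1
  allNum 41 fun a => allNum 42 fun b => a ≺ m ⋏ b ≺ m ⇛
    (upper a b ⇛ isOne (A a b)) ⋏
    (upper b a ⇛ isNegOne (A a b)) ⋏
    (.neg (upper a b) ⋏ .neg (upper b a) ⇛ isZero (A a b))

/-- `R J (M J) ^ r S = z`, for `R` of size `1 × m`, `M` of size `m × m` and `S` of size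
`m × 1`. -/
def pbCoeff (m : NTerm) (R M S : Mat) (r : NTerm) (z : Bits) : Formula :=
  exStr 20 fun J => exStr 21 fun MJ => exStr 22 fun P => exStr 23 fun RJ => exStr 24 fun U =>
    isJ m (mat J) ⋏
    matMul m m m M (mat J) (mat MJ) ⋏
    matPow m (mat MJ) r (mat P) ⋏
    matMul 1 m m R (mat J) (mat RJ) ⋏
    matMul 1 m m (mat RJ) (mat P) (mat U) ⋏
    dot m (mat U) S 0 0 z

/-- `P` is the PB matrix, of size `(d + 2) × (d + 1)`, of the skew symmetric matrix `A` of order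
`2 * (d + 1)` with block decomposition
`(0, a, R; -a, 0, -Sᵀ; -Rᵀ, S, M)`. It is a lower triangular Toeplitz matrix with first column
`1, a, R J S, R J (M J) S, …, R J (M J) ^ (d - 1) S`. -/
def isPBMatrix (d : NTerm) (A P : Mat) : Formula :=
  allNum 43 fun i => allNum 44 fun j => i ≺ d + 1 + 1 ⋏ j ≺ d + 1 ⇛
    (i ≺ j ⇛ isZero (P i j)) ⋏
    (i ≐ j ⇛ isOne (P i j)) ⋏
    (i ≐ j + 1 ⇛ eqBits (P i j) (A 0 1)) ⋏
    (allNum 45 fun r => i ≐ j + 1 + 1 + r ⇛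
      pbCoeff (d + d) (block A 0 (1 + 1)) (block A (1 + 1) (1 + 1)) (block A (1 + 1) 1) r (P i j))

/-- `pf A = z` for a skew symmetric matrix `A` of order `2 * N`. Row `k` of the array `Q` is the
sequence `(p_{N-k}, …, p_0)` of Pfaffian coefficients of the lower right block `A_k` of `A` of order
`2 * (N - k)`. The sequence of the empty matrix `A_N` is `(1)`, and the sequence of `A_k` is the PB
matrix of `A_k` times the sequence of `A_{k+1}`; in particular it is `(1, a)` for a matrix
`(0, a; -a, 0)`. The Pfaffian is the last coefficient `p_0` of `A_0 = A`. -/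
def pfaffian (N : NTerm) (A : Mat) (z : Bits) : Formula :=
  exStr 25 fun Q =>
    isOne (mat Q N 0) ⋏
    (allNum 46 fun k => allNum 47 fun d => k + d + 1 ≐ N ⇛ exStr 26 fun P =>
      isPBMatrix d (block A (k + k) (k + k)) (mat P) ⋏
      matMul (d + 1 + 1) (d + 1) 1 (mat P)
        (fun j _ => mat Q (k + 1) j) (fun i _ => mat Q k i)) ⋏
    eqBits (mat Q 0 N) z

/-- `A` is the matrix `(0, I; -I, 0)` of order `2 * N`, where `I` is the identity matrix of
order `N`. -/
def isBlockIdentity (N : NTerm) (A : Mat) : Formula :=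
  allNum 50 fun a => allNum 51 fun b => a ≺ N + N ⋏ b ≺ N + N ⇛
    (b ≐ a + N ⇛ isOne (A a b)) ⋏
    (a ≐ b + N ⇛ isNegOne (A a b)) ⋏
    (.neg (b ≐ a + N) ⋏ .neg (a ≐ b + N) ⇛ isZero (A a b))

/-- `z = (-1) ^ n`. -/
def isNegOnePow (n : NTerm) (z : Bits) : Formula :=
  ((exNum 52 fun t => n ≐ t + t) ⋏ isOne z) ⋎
  ((exNum 53 fun t => n ≐ t + t + 1) ⋏ isNegOne z)

/-- For all `n`, the matrix `A = (0, I; -I, 0)` with `I` of order `2 * n` exists, its Pfaffian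
exists, and every value of its Pfaffian is `(-1) ^ n`. -/
def pfBlockIdentity : Formula :=
  allNum 60 fun n =>
    (exStr 30 fun A => isBlockIdentity (n + n) (mat A)) ⋏
    (allStr 30 fun A => isBlockIdentity (n + n) (mat A) ⇛
      (exStr 31 fun Z => pfaffian (n + n) (mat A) (bits Z)) ⋏
      (allStr 31 fun Z => pfaffian (n + n) (mat A) (bits Z) ⇛ isNegOnePow n (bits Z)))

end VSharpL

/-!
It is enough to compute in an arbitrary model of `V#L`. Comprehension for bounded formulas gives
induction on bounded properties, hence the ordered semiring of numbers, every bounded set or array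
with a bounded definition, and integer addition and multiplication by `0` and `±1`.

Let `I` have order `2n` and number rows and columns from `0`. The trailing diagonal blocks of
`(0, I; -I, 0)` that the PB recursion meets have `1` at `(i, i + 2n)`, `-1` at `(i + 2n, i)` and `0`
elsewhere, so `a = 0`. A block of order at most `2n` vanishes, and its PB matrix is the identity on
top of a zero row. In a larger block `R` is the unit vector with index `2n - 2` and `S` is minus the
one with index `2n - 1`, so that `RJS = -1`, whereas `MJS = 0` because column `2n - 2` of `M`
vanishes. Its PB matrix is multiplication of polynomials by `1 - X²`. Going up from the empty matrix
the coefficients are thus those of `1`, `n` times, and then those of the powers of `1 - X²`. Matrix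
powering provides the latter, which makes the computation exist, and for any computation bounded
induction on `c` yields the degree `2c` and the leading coefficient `(-1)ᶜ` of `(1 - X²)ᶜ`.
-/

namespace VSharpL

section Renaming

/-- Simultaneous renaming of the number variables along `f` and of the string variables along
`g`. -/
def NTerm.rename (f g : ℕ → ℕ) : NTerm → NTerm
  | .var x => .var (f x)
  | .zero => .zero
  | .one => .one
  | .add s t => .add (s.rename f g) (t.rename f g)
  | .mul s t => .mul (s.rename f g) (t.rename f g)
  | .len X => .len (g X)

/-- Renaming of all variables, the bound ones included, along `f` and `g`. -/
def Formula.rename (f g : ℕ → ℕ) : Formula → Formula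
  | .eqN s t => .eqN (s.rename f g) (t.rename f g)
  | .eqS X Y => .eqS (g X) (g Y)
  | .le s t => .le (s.rename f g) (t.rename f g)
  | .mem t Y => .mem (t.rename f g) (g Y)
  | .neg φ => .neg (φ.rename f g)
  | .and φ ψ => .and (φ.rename f g) (ψ.rename f g)
  | .or φ ψ => .or (φ.rename f g) (ψ.rename f g)
  | .allN x φ => .allN (f x) (φ.rename f g)
  | .exN x φ => .exN (f x) (φ.rename f g)
  | .allS Y φ => .allS (g Y) (φ.rename f g)
  | .exS Y φ => .exS (g Y) (φ.rename f g)

variable {M : Model.{u, v}} {f g : ℕ → ℕ}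

theorem NTerm.eval_rename (f g : ℕ → ℕ) (t : NTerm) (e : ℕ → M.Num) (E : ℕ → M.Str) :
    (t.rename f g).eval M e E = t.eval M (e ∘ f) (E ∘ g) := by
  induction t with
  | var | zero | one | len => rfl
  | add s t hs ht | mul s t hs ht => simp only [NTerm.rename, NTerm.eval, hs, ht]

theorem NTerm.exists_occurs_of_occurs_rename {y : ℕ} {t : NTerm} (h : (t.rename f g).Occurs y) :
    ∃ x, t.Occurs x ∧ f x = y := by
  induction t with
  | var x => exact ⟨x, rfl, Eq.symm h⟩
  | zero | one | len => exact h.elim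
  | add s t hs ht | mul s t hs ht =>
    obtain h | h := h
    · exact (hs h).imp fun _ => And.imp_left .inl
    · exact (ht h).imp fun _ => And.imp_left .inr

theorem NTerm.not_occursStr_rename {X : ℕ} (hg : ∀ Y, g Y ≠ X) (t : NTerm) :
    ¬ (t.rename f g).OccursStr X := by
  induction t with
  | var | zero | one => exact id
  | len Y => exact fun h => hg Y (Eq.symm h)
  | add s t hs ht | mul s t hs ht => exact fun h => h.elim hs ht

theorem Formula.not_freeStr_rename {X : ℕ} (hg : ∀ Y, g Y ≠ X) (φ : Formula) :
    ¬ (φ.rename f g).FreeStr X := by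
  have ht := NTerm.not_occursStr_rename (f := f) hg
  induction φ with
  | eqN s t | le s t => exact fun h => h.elim (ht s) (ht t)
  | eqS Y Z => exact fun h => h.elim (fun h => hg Y h.symm) (fun h => hg Z h.symm)
  | mem t Y => exact fun h => h.elim (ht t) (fun h => hg Y h.symm)
  | neg _ h | allN _ _ h | exN _ _ h => exact h
  | and φ ψ hφ hψ | or φ ψ hφ hψ => exact fun h => h.elim hφ hψ
  | allS X φ h | exS X φ h => exact fun h' => h h'.2

theorem IsSigmaB0.rename (hf : f.Injective) {φ : Formula} (h : IsSigmaB0 φ) :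
    IsSigmaB0 (φ.rename f g) := by
  have not_occurs {x : ℕ} {t : NTerm} (ht : ¬ t.Occurs x) : ¬ (t.rename f g).Occurs (f x) := by
    intro h
    obtain ⟨y, hy, hxy⟩ := NTerm.exists_occurs_of_occurs_rename h
    exact ht (hf hxy ▸ hy)
  induction h with
  | eqN => exact .eqN _ _
  | eqS => exact .eqS _ _
  | le => exact .le _ _
  | mem => exact .mem _ _
  | neg _ h => exact .neg h
  | and _ _ h h' => exact .and h h'
  | or _ _ h h' => exact .or h h'
  | ball ht _ h => exact .ball (not_occurs ht) h
  | bex ht _ h => exact .bex (not_occurs ht) h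

theorem IsSigmaB0.sat_rename (hf : f.Injective) {φ : Formula} (h : IsSigmaB0 φ)
    (e : ℕ → M.Num) (E : ℕ → M.Str) :
    (φ.rename f g).Sat M e E ↔ φ.Sat M (e ∘ f) (E ∘ g) := by
  induction h generalizing e with
  | eqS => rfl
  | eqN | le => simp only [Formula.rename, Formula.Sat, NTerm.eval_rename]
  | mem => simp only [Formula.rename, Formula.Sat, NTerm.eval_rename, Function.comp_apply]
  | neg _ h => simp only [Formula.rename, Formula.Sat, h]
  | and _ _ h h' | or _ _ h h' => simp only [Formula.rename, Formula.Sat, h, h']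
  | ball _ _ h | bex _ _ h => simp only [Formula.rename, Formula.imp, Formula.Sat,
      NTerm.eval_rename, h, Function.update_comp_eq_of_injective _ hf]

end Renaming

section Environments

/-- The name of the bound variable `i` (left summand) or of the parameter `i` (right summand). -/
def varIndex : ℕ ⊕ ℕ ≃ ℕ := Equiv.natSumNatEquivNat

/-- The assignment that gives the bound variables the values `e` and the parameters the values
`p`. -/
def interleave {α : Type*} (e p : ℕ → α) (i : ℕ) : α :=
  Sum.elim e p (varIndex.symm i)

/-- A renaming of bound variables and parameters as a renaming of variable names. -/
def mapIndex (f : ℕ ⊕ ℕ → ℕ ⊕ ℕ) (i : ℕ) : ℕ :=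
  varIndex (f (varIndex.symm i))

/-- The environment `e` extended by the value `a` of a new innermost variable. -/
def consEnv {α : Type*} (a : α) (e : ℕ → α) : ℕ → α
  | 0 => a
  | i + 1 => e i

/-- The renaming that turns the innermost bound variable into a parameter, which can then be
quantified. -/
def bindIndex : ℕ ⊕ ℕ → ℕ ⊕ ℕ
  | .inl 0 => .inr 0
  | .inl (i + 1) => .inl i
  | .inr i => .inr (i + 1)

variable {α : Type*} (e p : ℕ → α) {f : ℕ ⊕ ℕ → ℕ ⊕ ℕ}

@[simp]
theorem interleave_varIndex (j : ℕ ⊕ ℕ) : interleave e p (varIndex j) = Sum.elim e p j := by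
  simp only [interleave, Equiv.symm_apply_apply]

@[simp]
theorem mapIndex_varIndex (j : ℕ ⊕ ℕ) : mapIndex f (varIndex j) = varIndex (f j) := by
  simp only [mapIndex, Equiv.symm_apply_apply]

theorem mapIndex_injective (hf : f.Injective) : (mapIndex f).Injective :=
  varIndex.injective.comp (hf.comp varIndex.symm.injective)

theorem bindIndex_injective : bindIndex.Injective := by
  rintro ((_ | i) | i) ((_ | j) | j) h <;> simp_all [bindIndex]

theorem funext_varIndex {s t : ℕ → α} (h : ∀ j, s (varIndex j) = t (varIndex j)) : s = t :=
  funext (varIndex.surjective.forall.mpr h)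

theorem interleave_comp_mapIndex_sumMap (g h : ℕ → ℕ) :
    interleave e p ∘ mapIndex (Sum.map g h) = interleave (e ∘ g) (p ∘ h) :=
  funext_varIndex fun j => by cases j <;> simp

theorem interleave_comp_inl : (interleave e p ∘ fun i => varIndex (.inl i)) = e := by
  funext i; simp

theorem interleave_comp_inr : (interleave e p ∘ fun i => varIndex (.inr i)) = p := by
  funext i; simp

theorem update_interleave_comp_bindIndex (a c : α) :
    Function.update (interleave e (consEnv c p)) (varIndex (.inr 0)) a ∘
      mapIndex bindIndex = interleave (consEnv a e) p :=
  funext_varIndex fun j => by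
    rcases j with (_ | j) | j <;> simp [bindIndex, Function.update_apply, consEnv]

theorem update_interleave_comp_mapIndex_succ (a c : α) :
    Function.update (interleave e (consEnv c p)) (varIndex (.inr 0)) a ∘
      mapIndex (Sum.map id Nat.succ) = interleave e p :=
  funext_varIndex fun j => by rcases j with j | j <;> simp [consEnv]

end Environments

section Definability
variable {M : Model.{u, v}}

instance : Zero M.Num := ⟨M.zero⟩
instance : One M.Num := ⟨M.one⟩
instance : Add M.Num := ⟨M.add⟩
instance : Mul M.Num := ⟨M.mul⟩
instance : LE M.Num := ⟨M.le⟩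

/-- The function of an environment `e` of de Bruijn indices is given by a term with parameters. It
is a class so that instance search finds the term. -/
class TermDefinable (f : (ℕ → M.Num) → M.Num) : Prop where
  exists_term : ∃ (t : NTerm) (p : ℕ → M.Num) (E : ℕ → M.Str),
    ∀ e, t.eval M (interleave e p) E = f e

/-- The property of an environment `e` of de Bruijn indices is given by a `Σ₀ᴮ` formula with
parameters of both sorts. It is a class so that instance search finds the formula. -/
class SigmaB0Definable (S : (ℕ → M.Num) → Prop) : Prop where
  exists_formula : ∃ (φ : Formula) (p : ℕ → M.Num) (E : ℕ → M.Str), IsSigmaB0 φ ∧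
    ∀ e, φ.Sat M (interleave e p) E ↔ S e

open TermDefinable SigmaB0Definable

theorem eval_rename_parameters {t : NTerm} {p p' : ℕ → M.Num} {E E' : ℕ → M.Str} {g : ℕ → ℕ}
    (hp : p' ∘ g = p) (hE : E' ∘ g = E) (e : ℕ → M.Num) :
    (t.rename (mapIndex (Sum.map id g)) g).eval M (interleave e p') E' =
      t.eval M (interleave e p) E := by
  rw [NTerm.eval_rename, interleave_comp_mapIndex_sumMap, hp, hE, Function.comp_id]

theorem IsSigmaB0.sat_rename_parameters {φ : Formula} (hφ : IsSigmaB0 φ) {p p' : ℕ → M.Num}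
    {E E' : ℕ → M.Str} {g : ℕ → ℕ} (hg : g.Injective) (hp : p' ∘ g = p) (hE : E' ∘ g = E)
    (e : ℕ → M.Num) :
    (φ.rename (mapIndex (Sum.map id g)) g).Sat M (interleave e p') E' ↔
      φ.Sat M (interleave e p) E := by
  rw [hφ.sat_rename (mapIndex_injective (Function.injective_id.sumMap hg)),
    interleave_comp_mapIndex_sumMap, hp, hE, Function.comp_id]

/-- A pair of evaluations can use the same parameters: those of the first are moved to the left half
of the names, those of the second to the right half. -/
theorem exists_common_parameters_term (f g : (ℕ → M.Num) → M.Num) [hf : TermDefinable f]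
    [hg : TermDefinable g] :
    ∃ (s t : NTerm) (p : ℕ → M.Num) (E : ℕ → M.Str), ∀ e,
      s.eval M (interleave e p) E = f e ∧ t.eval M (interleave e p) E = g e := by
  obtain ⟨s, p, E, hs⟩ := hf.exists_term
  obtain ⟨t, q, F, ht⟩ := hg.exists_term
  exact ⟨_, _, interleave p q, interleave E F, fun e =>
    ⟨(eval_rename_parameters (interleave_comp_inl p q) (interleave_comp_inl E F) e).trans (hs e),
      (eval_rename_parameters (interleave_comp_inr p q) (interleave_comp_inr E F) e).trans (ht e)⟩⟩

theorem exists_common_parameters_formula (S T : (ℕ → M.Num) → Prop) [hS : SigmaB0Definable S]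
    [hT : SigmaB0Definable T] :
    ∃ (φ ψ : Formula) (p : ℕ → M.Num) (E : ℕ → M.Str), IsSigmaB0 φ ∧ IsSigmaB0 ψ ∧ ∀ e,
      (φ.Sat M (interleave e p) E ↔ S e) ∧ (ψ.Sat M (interleave e p) E ↔ T e) := by
  obtain ⟨φ, p, E, hφ, hs⟩ := hS.exists_formula
  obtain ⟨ψ, q, F, hψ, ht⟩ := hT.exists_formula
  have inl_injective := varIndex.injective.comp (Sum.inl_injective (β := ℕ))
  have inr_injective := varIndex.injective.comp (Sum.inr_injective (α := ℕ))
  exact ⟨_, _, interleave p q, interleave E F,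
    hφ.rename (mapIndex_injective (Function.injective_id.sumMap inl_injective)),
    hψ.rename (mapIndex_injective (Function.injective_id.sumMap inr_injective)), fun e =>
    ⟨(hφ.sat_rename_parameters inl_injective (interleave_comp_inl p q)
        (interleave_comp_inl E F) e).trans (hs e),
      (hψ.sat_rename_parameters inr_injective (interleave_comp_inr p q)
        (interleave_comp_inr E F) e).trans (ht e)⟩⟩

theorem exists_common_parameters_term_formula (f : (ℕ → M.Num) → M.Num) (S : (ℕ → M.Num) → Prop)
    [hf : TermDefinable f] [hS : SigmaB0Definable S] :
    ∃ (t : NTerm) (φ : Formula) (p : ℕ → M.Num) (E : ℕ → M.Str), IsSigmaB0 φ ∧ ∀ e,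
      t.eval M (interleave e p) E = f e ∧ (φ.Sat M (interleave e p) E ↔ S e) := by
  obtain ⟨t, p, E, ht⟩ := hf.exists_term
  obtain ⟨φ, q, F, hφ, hs⟩ := hS.exists_formula
  have inr_injective := varIndex.injective.comp (Sum.inr_injective (α := ℕ))
  exact ⟨_, _, interleave p q, interleave E F,
    hφ.rename (mapIndex_injective (Function.injective_id.sumMap inr_injective)), fun e =>
    ⟨(eval_rename_parameters (interleave_comp_inl p q) (interleave_comp_inl E F) e).trans (ht e),
      (hφ.sat_rename_parameters inr_injective (interleave_comp_inr p q)
        (interleave_comp_inr E F) e).trans (hs e)⟩⟩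

theorem SigmaB0Definable.congr {S T : (ℕ → M.Num) → Prop} (hS : SigmaB0Definable S)
    (h : ∀ e, T e ↔ S e) : SigmaB0Definable T := by
  rwa [show T = S from funext fun e => propext (h e)]

theorem TermDefinable.shift {f : (ℕ → M.Num) → M.Num} (hf : TermDefinable f) :
    TermDefinable fun e => f fun i => e (i + 1) := by
  obtain ⟨t, p, E, h⟩ := hf.exists_term
  refine ⟨t.rename (mapIndex (Sum.map Nat.succ id)) id, p, E, fun e => ?_⟩
  rw [NTerm.eval_rename, ← h, interleave_comp_mapIndex_sumMap]
  rfl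

section Terms
variable (f g : (ℕ → M.Num) → M.Num) [hf : TermDefinable f] [TermDefinable g]

instance (i : ℕ) : TermDefinable (M := M) (fun e => e i) :=
  ⟨.var (varIndex (.inl i)), fun _ => M.zero, fun _ => M.str_nonempty.some,
    fun _ => by simp [NTerm.eval]⟩

instance (c : M.Num) : TermDefinable (M := M) (fun _ => c) :=
  ⟨.var (varIndex (.inr 0)), fun _ => c, fun _ => M.str_nonempty.some,
    fun _ => by simp [NTerm.eval]⟩

instance : TermDefinable (fun e => f e + g e) :=
  let ⟨s, t, p, E, h⟩ := exists_common_parameters_term f g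
  ⟨.add s t, p, E, fun e => congrArg₂ M.add (h e).1 (h e).2⟩

instance : TermDefinable (fun e => f e * g e) :=
  let ⟨s, t, p, E, h⟩ := exists_common_parameters_term f g
  ⟨.mul s t, p, E, fun e => congrArg₂ M.mul (h e).1 (h e).2⟩

instance : SigmaB0Definable (fun e => f e = g e) :=
  let ⟨s, t, p, E, h⟩ := exists_common_parameters_term f g
  ⟨.eqN s t, p, E, .eqN _ _, fun e => Eq.congr (h e).1 (h e).2⟩

instance : SigmaB0Definable (fun e => f e ≤ g e) :=
  let ⟨s, t, p, E, h⟩ := exists_common_parameters_term f g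
  ⟨.le s t, p, E, .le _ _, fun e => iff_of_eq (congrArg₂ M.le (h e).1 (h e).2)⟩

instance (X : M.Str) : SigmaB0Definable (fun e => M.mem (f e) X) := by
  obtain ⟨t, p, E, h⟩ := hf.exists_term
  refine ⟨.mem (t.rename (mapIndex (Sum.map id fun i => varIndex (.inl i)))
    fun i => varIndex (.inl i)) (varIndex (.inr 0)), interleave p p, interleave E fun _ => X,
    .mem _ _, fun e => ?_⟩
  simp only [Formula.Sat, eval_rename_parameters (interleave_comp_inl p p)
    (interleave_comp_inl E _), h, interleave_varIndex, Sum.elim_inr]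

end Terms

section Formulas
variable (S T : (ℕ → M.Num) → Prop) [hS : SigmaB0Definable S] [SigmaB0Definable T]

instance : SigmaB0Definable (fun e => ¬ S e) :=
  let ⟨φ, p, E, hφ, h⟩ := hS.exists_formula
  ⟨.neg φ, p, E, .neg hφ, fun e => not_congr (h e)⟩

instance : SigmaB0Definable (fun e => S e ∧ T e) :=
  let ⟨φ, ψ, p, E, hφ, hψ, h⟩ := exists_common_parameters_formula S T
  ⟨.and φ ψ, p, E, .and hφ hψ, fun e => and_congr (h e).1 (h e).2⟩

instance : SigmaB0Definable (fun e => S e ∨ T e) :=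
  let ⟨φ, ψ, p, E, hφ, hψ, h⟩ := exists_common_parameters_formula S T
  ⟨.or φ ψ, p, E, .or hφ hψ, fun e => or_congr (h e).1 (h e).2⟩

instance : SigmaB0Definable (fun e => S e → T e) :=
  .congr (S := fun e => ¬ S e ∨ T e) inferInstance fun _ => imp_iff_not_or

instance : SigmaB0Definable (fun e => S e ↔ T e) :=
  .congr (S := fun e => (S e → T e) ∧ (T e → S e)) inferInstance fun _ =>
    iff_iff_implies_and_implies

instance (P : Prop) : SigmaB0Definable (M := M) (fun _ => P) := by
  by_cases h : P
  · exact .congr (S := fun _ => M.zero = M.zero) inferInstance fun _ => by simp [h]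
  · exact .congr (S := fun _ => ¬ M.zero = M.zero) inferInstance fun _ => by simp [h]

end Formulas

section BoundedQuantifiers
variable (f : (ℕ → M.Num) → M.Num) (S : (ℕ → M.Num) → M.Num → Prop) [TermDefinable f]
  [SigmaB0Definable fun e => S (fun i => e (i + 1)) (e 0)]

instance SigmaB0Definable.bex_le : SigmaB0Definable (fun e => ∃ a, a ≤ f e ∧ S e a) := by
  obtain ⟨t, φ, p, E, hφ, h⟩ :=
    exists_common_parameters_term_formula f fun e => S (fun i => e (i + 1)) (e 0)
  refine ⟨.exN (varIndex (.inr 0)) (.and (.le (.var (varIndex (.inr 0)))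
      (t.rename (mapIndex (Sum.map id Nat.succ)) id)) (φ.rename (mapIndex bindIndex) id)),
    consEnv M.zero p, E,
    .bex (fun ht => ?_) (hφ.rename (mapIndex_injective bindIndex_injective)), fun e => ?_⟩
  · obtain ⟨i, -, hi⟩ := NTerm.exists_occurs_of_occurs_rename ht
    obtain ⟨j | j, rfl⟩ := varIndex.surjective i <;> simp at hi
  · simp only [Formula.Sat, hφ.sat_rename (mapIndex_injective bindIndex_injective),
      NTerm.eval_rename, update_interleave_comp_bindIndex, update_interleave_comp_mapIndex_succ,
      Function.comp_id, h, NTerm.eval, Function.update_self]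
    rfl

instance SigmaB0Definable.ball_le : SigmaB0Definable (fun e => ∀ a, a ≤ f e → S e a) :=
  .congr (S := fun e => ¬ ∃ a, a ≤ f e ∧ ¬ S e a) inferInstance fun _ => by
    push Not; rfl

end BoundedQuantifiers

end Definability

section Axioms

/-- The structure is a model of `V#L`. -/
class IsModel (M : Model.{u, v}) : Prop where
  models_theory : M.Models theory

/-- The content of the axioms 2-BASIC, with `x < y` spelled out as `x ≤ y ∧ x ≠ y`. -/
structure BasicAxioms (M : Model.{u, v}) : Prop where
  succ_ne_zero : ∀ x : M.Num, x + 1 ≠ 0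
  succ_injective : ∀ x y : M.Num, x + 1 = y + 1 → x = y
  add_zero : ∀ x : M.Num, x + 0 = x
  add_succ : ∀ x y : M.Num, x + (y + 1) = x + y + 1
  mul_zero : ∀ x : M.Num, x * 0 = 0
  mul_succ : ∀ x y : M.Num, x * (y + 1) = x * y + x
  le_antisymm : ∀ x y : M.Num, x ≤ y ∧ y ≤ x → x = y
  le_add_right : ∀ x y : M.Num, x ≤ x + y
  zero_le : ∀ x : M.Num, 0 ≤ x
  le_total : ∀ x y : M.Num, x ≤ y ∨ y ≤ x
  le_iff_lt_succ : ∀ x y : M.Num, x ≤ y ↔ x ≤ y + 1 ∧ x ≠ y + 1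
  exists_pred : ∀ x : M.Num, x ≠ 0 → ∃ y, y ≤ x ∧ y + 1 = x
  lt_len_of_mem : ∀ (y : M.Num) (X : M.Str), M.mem y X → y ≤ M.len X ∧ y ≠ M.len X
  mem_of_succ_eq_len : ∀ (y : M.Num) (X : M.Str), y + 1 = M.len X → M.mem y X
  str_ext : ∀ X Y : M.Str, M.len X = M.len Y ∧ (∀ x : M.Num, x ≤ M.len X ∧ x ≠ M.len X →
    (M.mem x X ↔ M.mem x Y)) → X = Y

variable {M : Model.{u, v}}

theorem sat_imp {φ ψ : Formula} {e : ℕ → M.Num} {E : ℕ → M.Str} :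
    (φ.imp ψ).Sat M e E ↔ (φ.Sat M e E → ψ.Sat M e E) :=
  imp_iff_not_or.symm

theorem sat_iff {φ ψ : Formula} {e : ℕ → M.Num} {E : ℕ → M.Str} :
    (φ.iff ψ).Sat M e E ↔ (φ.Sat M e E ↔ ψ.Sat M e E) := by
  simp only [Formula.iff, Formula.Sat, sat_imp, iff_iff_implies_and_implies]

variable [hM : IsModel M]

theorem basicAxioms : BasicAxioms M := by
  have basic_sat (φ : Formula) (hφ : φ ∈ basic) (e : ℕ → M.Num) (E : ℕ → M.Str) : φ.Sat M e E :=
    hM.models_theory φ (.inl (.inl hφ)) e E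
  simp only [basic, Set.mem_insert_iff, Set.mem_singleton_iff, forall_eq_or_imp, forall_eq,
    Formula.Sat, sat_imp, sat_iff] at basic_sat
  obtain ⟨h1, h2, h3, h4, h5, h6, h7, h8, h9, h10, h11, h12, h13, h14, h15⟩ := basic_sat
  let E (X Y : M.Str) : ℕ → M.Str := consEnv X fun _ => Y
  let E₀ : ℕ → M.Str := fun _ => M.str_nonempty.some
  let e (x y : M.Num) : ℕ → M.Num := consEnv x fun _ => y
  exact ⟨fun x => h1 (e x x) E₀, fun x y => h2 (e x y) E₀, fun x => h3 (e x x) E₀,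
    fun x y => h4 (e x y) E₀, fun x => h5 (e x x) E₀, fun x y => h6 (e x y) E₀,
    fun x y => h7 (e x y) E₀, fun x y => h8 (e x y) E₀, fun x => h9 (e x x) E₀,
    fun x y => h10 (e x y) E₀, fun x y => h11 (e x y) E₀, fun x => h12 (e x x) E₀,
    fun y X => h13 (e y y) (E X X), fun y X => h14 (e y y) (E X X),
    fun X Y => h15 (e 0 0) (E X Y)⟩

theorem exists_str_mem_iff (S : M.Num → Prop) [hS : SigmaB0Definable fun e => S (e 0)]
    (y : M.Num) :
    ∃ X, M.len X ≤ y ∧ ∀ x, x ≤ y ∧ x ≠ y → (M.mem x X ↔ S x) := by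
  obtain ⟨φ, p, E, hφ, hφS⟩ := hS.exists_formula
  -- Parameters are shifted to make room for the bound `y` and for the string variable of the axiom.
  have injective_shift : (mapIndex (Sum.map id Nat.succ)).Injective :=
    mapIndex_injective (Function.injective_id.sumMap Nat.succ_injective)
  have ne : varIndex (.inl 0) ≠ varIndex (.inr 0) := by simp
  let e₀ : ℕ → M.Num := interleave (fun _ => 0) (consEnv y p)
  obtain ⟨X, len_le, mem_iff⟩ := hM.models_theory
    (compAxiom (φ.rename (mapIndex (Sum.map id Nat.succ)) Nat.succ) (varIndex (.inl 0))
      (varIndex (.inr 0)) 0)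
    (.inl (.inr ⟨_, _, _, _, hφ.rename injective_shift, ne,
      Formula.not_freeStr_rename (by simp) _, rfl⟩)) e₀ (consEnv M.str_nonempty.some E)
  have eval_y : e₀ (varIndex (.inr 0)) = y := interleave_varIndex _ _ _
  have update_comp (x : M.Num) : Function.update e₀ (varIndex (.inl 0)) x ∘
      mapIndex (Sum.map id Nat.succ) = interleave (Function.update (fun _ => 0) 0 x) p :=
    funext_varIndex fun j => by
      rcases j with j | j <;> simp [e₀, consEnv, Function.update_apply]
  simp only [Formula.Sat, Formula.lt, sat_imp, sat_iff, NTerm.eval, Function.update_self,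
    Function.update_of_ne ne.symm, eval_y, hφ.sat_rename injective_shift,
    update_comp] at len_le mem_iff
  exact ⟨X, len_le, fun x hx => (mem_iff x hx).trans (hφS _)⟩

theorem num_le_refl (x : M.Num) : x ≤ x := by
  simpa only [basicAxioms.add_zero] using basicAxioms.le_add_right x 0

theorem num_succ_le_of_le_of_ne {x y : M.Num} (hxy : x ≤ y) (hne : x ≠ y) : x + 1 ≤ y := by
  refine (basicAxioms.le_total (x + 1) y).elim id fun hyx => ?_
  by_cases h : y = x + 1
  · exact h ▸ num_le_refl y
  · exact absurd (basicAxioms.le_antisymm x y ⟨hxy, (basicAxioms.le_iff_lt_succ y x).2 ⟨hyx, h⟩⟩)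
      hne

theorem num_le_of_succ_le_succ {x y : M.Num} (h : x + 1 ≤ y + 1) : x ≤ y := by
  refine (basicAxioms.le_total x y).elim id fun hyx => ?_
  by_cases hne : x + 1 = y + 1
  · exact basicAxioms.succ_injective x y hne ▸ num_le_refl x
  · have hyx' := (basicAxioms.le_iff_lt_succ y x).1 hyx
    exact absurd (basicAxioms.le_antisymm y (x + 1)
      ⟨hyx'.1, (basicAxioms.le_iff_lt_succ (x + 1) y).2 ⟨h, hne⟩⟩) hyx'.2

/-- If `S` failed at `a`, the string comprehended from `S` below `a + 1` would have a last element
`w < a`, although `S` passes from `w` to `w + 1`. -/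
theorem num_induction {S : M.Num → Prop} [SigmaB0Definable fun e => S (e 0)] (zero : S 0)
    (succ : ∀ x, S x → S (x + 1)) (a : M.Num) : S a := by
  have B := basicAxioms (M := M)
  obtain ⟨X, len_le, mem_iff⟩ := exists_str_mem_iff S (a + 1)
  have mem_iff_of_le {x : M.Num} (hx : x ≤ a) : M.mem x X ↔ S x :=
    mem_iff x ((B.le_iff_lt_succ x a).1 hx)
  have zero_mem : M.mem 0 X := (mem_iff_of_le (B.zero_le a)).2 zero
  obtain ⟨w, -, hw⟩ := B.exists_pred (M.len X) fun h => (B.lt_len_of_mem 0 X zero_mem).2 h.symm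
  have w_le : w ≤ a := num_le_of_succ_le_succ (hw ▸ len_le)
  have w_mem : S w := (mem_iff_of_le w_le).1 (B.mem_of_succ_eq_len w X hw)
  obtain rfl | hne := eq_or_ne w a
  · exact w_mem
  · have succ_mem := (mem_iff_of_le (num_succ_le_of_le_of_ne w_le hne)).2 (succ w w_mem)
    exact absurd hw (B.lt_len_of_mem _ X succ_mem).2

end Axioms

section Numbers
variable {M : Model.{u, v}} [IsModel M]

theorem num_zero_add (x : M.Num) : 0 + x = x :=
  num_induction (S := fun x => 0 + x = x) (basicAxioms.add_zero 0)
    (fun x hx => by rw [basicAxioms.add_succ, hx]) x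

theorem num_succ_add (x y : M.Num) : x + 1 + y = x + y + 1 :=
  num_induction (S := fun y => x + 1 + y = x + y + 1) (by simp only [basicAxioms.add_zero])
    (fun y hy => by simp only [basicAxioms.add_succ, hy]) y

theorem num_add_comm (x y : M.Num) : x + y = y + x :=
  num_induction (S := fun y => x + y = y + x) (by rw [basicAxioms.add_zero, num_zero_add])
    (fun y hy => by rw [basicAxioms.add_succ, hy, num_succ_add]) y

theorem num_add_assoc (x y z : M.Num) : x + y + z = x + (y + z) :=
  num_induction (S := fun z => x + y + z = x + (y + z)) (by simp only [basicAxioms.add_zero])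
    (fun z hz => by simp only [basicAxioms.add_succ, hz]) z

instance : AddCommMonoid M.Num where
  add_assoc := num_add_assoc
  zero_add := num_zero_add
  add_zero := basicAxioms.add_zero
  add_comm := num_add_comm
  nsmul := nsmulRec

theorem num_zero_mul (x : M.Num) : 0 * x = 0 :=
  num_induction (S := fun x => 0 * x = 0) (basicAxioms.mul_zero 0)
    (fun x hx => by rw [basicAxioms.mul_succ, hx, add_zero]) x

theorem num_succ_mul (x y : M.Num) : (x + 1) * y = x * y + y :=
  num_induction (S := fun y => (x + 1) * y = x * y + y)
    (by simp only [basicAxioms.mul_zero, add_zero])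
    (fun y hy => by simp only [basicAxioms.mul_succ, hy]; abel) y

theorem num_mul_comm (x y : M.Num) : x * y = y * x :=
  num_induction (S := fun y => x * y = y * x) (by rw [basicAxioms.mul_zero, num_zero_mul])
    (fun y hy => by rw [basicAxioms.mul_succ, hy, num_succ_mul]) y

theorem num_mul_add (x y z : M.Num) : x * (y + z) = x * y + x * z :=
  num_induction (S := fun z => x * (y + z) = x * y + x * z)
    (by simp only [basicAxioms.mul_zero, add_zero])
    (fun z hz => by rw [← add_assoc, basicAxioms.mul_succ, basicAxioms.mul_succ, hz, add_assoc]) z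

theorem num_mul_assoc (x y z : M.Num) : x * y * z = x * (y * z) :=
  num_induction (S := fun z => x * y * z = x * (y * z)) (by simp only [basicAxioms.mul_zero])
    (fun z hz => by rw [basicAxioms.mul_succ, basicAxioms.mul_succ, hz, num_mul_add]) z

theorem num_mul_one (x : M.Num) : x * 1 = x := by
  rw [← zero_add 1, basicAxioms.mul_succ, basicAxioms.mul_zero, zero_add]

instance : CommSemiring M.Num where
  left_distrib := num_mul_add
  right_distrib x y z := by rw [num_mul_comm, num_mul_add, num_mul_comm z, num_mul_comm z]
  zero_mul := num_zero_mul
  mul_zero := basicAxioms.mul_zero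
  mul_assoc := num_mul_assoc
  one_mul x := by rw [num_mul_comm, num_mul_one]
  mul_one := num_mul_one
  mul_comm := num_mul_comm

theorem num_add_right_cancel {x y z : M.Num} : x + z = y + z → x = y :=
  num_induction (S := fun z => x + z = y + z → x = y) (by simp only [add_zero, imp_self])
    (fun z ih h => ih (basicAxioms.succ_injective _ _ (by rwa [add_assoc, add_assoc]))) z

theorem num_exists_add_of_le {x y : M.Num} (hxy : x ≤ y) : ∃ z, y = x + z := by
  have B := basicAxioms (M := M)
  have bounded : ∀ y, x ≤ y → ∃ z, z ≤ y ∧ y = x + z := fun y => by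
    refine num_induction (S := fun y => x ≤ y → ∃ z, z ≤ y ∧ y = x + z)
      (fun h => ⟨0, num_le_refl 0, ?_⟩) (fun y ih h => ?_) y
    · rw [add_zero, B.le_antisymm x 0 ⟨h, B.zero_le x⟩]
    · by_cases hne : x = y + 1
      · exact ⟨0, B.zero_le _, by rw [add_zero, hne]⟩
      · obtain ⟨z, -, rfl⟩ := ih ((B.le_iff_lt_succ x y).2 ⟨h, hne⟩)
        exact ⟨z + 1, by rw [add_assoc, add_comm x]; exact B.le_add_right _ _, add_assoc _ _ _⟩
  exact (bounded y hxy).imp fun _ => And.right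

open Classical in
noncomputable instance : LinearOrder M.Num where
  le_refl := num_le_refl
  le_trans x y z hxy hyz := by
    obtain ⟨a, rfl⟩ := num_exists_add_of_le hxy
    obtain ⟨b, rfl⟩ := num_exists_add_of_le hyz
    exact add_assoc x a b ▸ basicAxioms.le_add_right x (a + b)
  le_antisymm x y hxy hyx := basicAxioms.le_antisymm x y ⟨hxy, hyx⟩
  le_total := basicAxioms.le_total
  toDecidableLE := Classical.decRel _

instance : CanonicallyOrderedAdd M.Num where
  exists_add_of_le := num_exists_add_of_le
  le_self_add := basicAxioms.le_add_right
  le_add_self x y := add_comm x y ▸ basicAxioms.le_add_right x y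

theorem num_eq_zero_or_eq_succ (x : M.Num) : x = 0 ∨ ∃ y, x = y + 1 :=
  or_iff_not_imp_left.2 fun h => (basicAxioms.exists_pred x h).imp fun _ hy => hy.2.symm

theorem num_mul_lt_mul_left {a b c : M.Num} (hab : a < b) (hc : 0 < c) : c * a < c * b := by
  obtain ⟨z, rfl⟩ := exists_add_of_le hab.le
  obtain rfl | ⟨z, rfl⟩ := num_eq_zero_or_eq_succ z
  · exact absurd hab (by rw [add_zero]; exact lt_irrefl a)
  obtain rfl | ⟨c, rfl⟩ := num_eq_zero_or_eq_succ c
  · exact absurd hc (lt_irrefl 0)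
  refine lt_of_le_of_ne (le_iff_exists_add.2 ⟨(c + 1) * (z + 1), by ring⟩) fun h => ?_
  refine basicAxioms.succ_ne_zero (c * z + c + z) (num_add_right_cancel (z := (c + 1) * a) ?_)
  exact Eq.trans (by ring) (h.symm.trans (zero_add _).symm)

instance : IsStrictOrderedRing M.Num where
  add_le_add_left _ _ h _ := by
    obtain ⟨a, rfl⟩ := exists_add_of_le h
    exact le_iff_exists_add.2 ⟨a, by ring⟩
  le_of_add_le_add_left x _ _ h := by
    obtain ⟨a, ha⟩ := exists_add_of_le h
    exact le_iff_exists_add.2 ⟨a, num_add_right_cancel (z := x) (by rw [add_comm, ha]; ring)⟩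
  zero_le_one := zero_le
  exists_pair_ne := ⟨1, 0, zero_add (1 : M.Num) ▸ basicAxioms.succ_ne_zero 0⟩
  mul_lt_mul_of_pos_left _ hc _ _ hab := num_mul_lt_mul_left hab hc
  mul_lt_mul_of_pos_right c hc a b hab := by
    rw [mul_comm a, mul_comm b]; exact num_mul_lt_mul_left hab hc

theorem num_lt_succ_iff {x y : M.Num} : x < y + 1 ↔ x ≤ y :=
  lt_iff_le_and_ne.trans (basicAxioms.le_iff_lt_succ x y).symm

theorem num_succ_le_iff {x y : M.Num} : x + 1 ≤ y ↔ x < y := by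
  rw [← not_lt, num_lt_succ_iff, not_le]

section BoundedQuantifiers
variable (f g : (ℕ → M.Num) → M.Num) (S : (ℕ → M.Num) → M.Num → Prop) [hf : TermDefinable f]
  [TermDefinable g] [SigmaB0Definable fun e => S (fun i => e (i + 1)) (e 0)]

instance : SigmaB0Definable (fun e => f e < g e) :=
  .congr (S := fun e => ¬ g e ≤ f e) inferInstance fun _ => not_le.symm

omit [TermDefinable g] in
instance SigmaB0Definable.bex_lt : SigmaB0Definable (fun e => ∃ a, a < f e ∧ S e a) :=
  .congr (S := fun e => ∃ a, a ≤ f e ∧ a < f e ∧ S e a) (have := hf.shift; inferInstance)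
    fun _ => exists_congr fun _ => ⟨fun h => ⟨h.1.le, h⟩, And.right⟩

omit [TermDefinable g] in
instance SigmaB0Definable.ball_lt : SigmaB0Definable (fun e => ∀ a, a < f e → S e a) :=
  .congr (S := fun e => ¬ ∃ a, a < f e ∧ ¬ S e a) (have := hf.shift; inferInstance) fun _ => by
    push Not; rfl

end BoundedQuantifiers

end Numbers

section Semantics
variable {M : Model.{u, v}} [IsModel M]

/-- The meaning of a formula that is used as a bit predicate: a set of positions. -/
abbrev BitSet (M : Model.{u, v}) : Type u := M.Num → Prop

/-- A two-dimensional array of sets of positions, the meaning of a formula that is used as a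
matrix. -/
abbrev BitMatrix (M : Model.{u, v}) : Type u := M.Num → M.Num → BitSet M

/-- The code of the integer `0`. -/
def zeroBits : BitSet M := fun _ => False

/-- The code of the integer `1`. -/
def oneBits : BitSet M := fun i => i = 1

/-- The code of the integer `-1`. -/
def negOneBits : BitSet M := fun i => i = 0 ∨ i = 1

/-- The meaning of `carry`. -/
def HasCarry (b c : BitSet M) (i : M.Num) : Prop :=
  ∃ k < i, b k ∧ c k ∧ ∀ j, k < j → j < i → b j ∨ c j

/-- The meaning of `natAdd`. -/
def IsNatSum (b c d : BitSet M) : Prop :=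
  ∀ i, d i ↔ ¬ (¬ (b i ↔ c i) ↔ HasCarry b c i)

/-- The meaning of `shift`. -/
def shiftBits (s : M.Num) (b : BitSet M) : BitSet M := fun j => ∃ t, t + s = j ∧ b t

/-- The meaning of `pair`. -/
def pairNum (x y : M.Num) : M.Num := (x + y) * (x + y + 1) + (1 + 1) * y

/-- The meaning of `row`. -/
def rowBits (W : M.Str) (l : M.Num) : BitSet M := fun i => M.mem (pairNum l i) W

/-- The meaning of `natMul`. -/
def IsNatProd (b c d : BitSet M) : Prop :=
  ∃ l, (∀ i, c i → i < l) ∧ ∃ W, rowBits W 0 = zeroBits ∧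
    (∀ i < l, (c i → IsNatSum (rowBits W i) (shiftBits i b) (rowBits W (i + 1))) ∧
      (¬ c i → rowBits W (i + 1) = rowBits W i)) ∧
    rowBits W l = d

/-- The meaning of `mag`. -/
def magBits (b : BitSet M) : BitSet M := fun i => b (i + 1)

/-- The meaning of `nonzero`. -/
def IsNonzero (b : BitSet M) : Prop := ∃ i, magBits b i

/-- The meaning of `isInt`. -/
def IsIntCode (b : BitSet M) : Prop := b 0 → IsNonzero b

/-- The meaning of `intAdd`. -/
def IsIntSum (b c d : BitSet M) : Prop :=
  IsIntCode d ∧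
    ((b 0 ↔ c 0) ∧ (d 0 ↔ b 0) ∧ IsNatSum (magBits b) (magBits c) (magBits d) ∨
      ¬ (b 0 ↔ c 0) ∧ ((d 0 ↔ b 0) ∧ IsNatSum (magBits c) (magBits d) (magBits b) ∨
        (d 0 ↔ c 0) ∧ IsNatSum (magBits b) (magBits d) (magBits c)))

/-- The meaning of `intMul`. -/
def IsIntProd (b c d : BitSet M) : Prop :=
  IsIntCode d ∧ IsNatProd (magBits b) (magBits c) (magBits d) ∧
    (IsNonzero d → (d 0 ↔ ¬ (b 0 ↔ c 0)))

/-- The meaning of `mat`. -/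
def matEntry (X : M.Str) : BitMatrix M := fun a b => rowBits X (pairNum a b)

/-- The meaning of `mats`. -/
def matsEntry (P : M.Str) (k : M.Num) : BitMatrix M := fun a b =>
  rowBits P (pairNum (pairNum k a) b)

/-- The meaning of `block`. -/
def blockEntry (A : BitMatrix M) (s t : M.Num) : BitMatrix M := fun a b => A (s + a) (t + b)

/-- The meaning of `isId`. -/
def IsIdentity (m : M.Num) (A : BitMatrix M) : Prop :=
  ∀ a b, a < m → b < m → (a = b → A a b = oneBits) ∧ (a ≠ b → A a b = zeroBits)

/-- The meaning of `dot`. -/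
def IsDot (q : M.Num) (x y : M.Num → BitSet M) (d : BitSet M) : Prop :=
  ∃ T, rowBits T 0 = zeroBits ∧
    (∀ l < q, ∃ V, IsIntProd (x l) (y l) (M.mem · V) ∧
      IsIntSum (rowBits T l) (M.mem · V) (rowBits T (l + 1))) ∧
    rowBits T q = d

/-- The meaning of `matMul`. -/
def IsMatProd (p q r : M.Num) (A B C : BitMatrix M) : Prop :=
  ∀ a b, a < p → b < r → IsDot q (A a) (fun l => B l b) (C a b)

/-- The meaning of `matPow`. -/
def IsMatPow (m : M.Num) (A : BitMatrix M) (n : M.Num) (B : BitMatrix M) : Prop :=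
  ∃ P, IsIdentity m (matsEntry P 0) ∧
    (∀ k < n, IsMatProd m m m (matsEntry P k) A (matsEntry P (k + 1))) ∧
    ∀ a b, a < m → b < m → matsEntry P n a b = B a b

/-- Position `(a, b)` holds the upper right entry of a `2 × 2` diagonal block. -/
def IsUpper (a b : M.Num) : Prop := ∃ t, a = t + t ∧ b = t + t + 1

/-- The meaning of `isJ`. -/
def IsSymplecticJ (m : M.Num) (A : BitMatrix M) : Prop :=
  ∀ a b, a < m → b < m → (IsUpper a b → A a b = oneBits) ∧ (IsUpper b a → A a b = negOneBits) ∧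
    (¬ IsUpper a b ∧ ¬ IsUpper b a → A a b = zeroBits)

/-- The meaning of `pbCoeff`. -/
def IsPBCoeff (m : M.Num) (R A S : BitMatrix M) (r : M.Num) (z : BitSet M) : Prop :=
  ∃ J AJ P RJ U : M.Str, IsSymplecticJ m (matEntry J) ∧
    IsMatProd m m m A (matEntry J) (matEntry AJ) ∧ IsMatPow m (matEntry AJ) r (matEntry P) ∧
    IsMatProd 1 m m R (matEntry J) (matEntry RJ) ∧
    IsMatProd 1 m m (matEntry RJ) (matEntry P) (matEntry U) ∧
    IsDot m (matEntry U 0) (fun l => S l 0) z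

/-- The meaning of `isPBMatrix`. -/
def IsPBMatrix (d : M.Num) (A P : BitMatrix M) : Prop :=
  ∀ i j, i < d + 1 + 1 → j < d + 1 → (i < j → P i j = zeroBits) ∧ (i = j → P i j = oneBits) ∧
    (i = j + 1 → P i j = A 0 1) ∧
    ∀ r, i = j + 1 + 1 + r → IsPBCoeff (d + d) (blockEntry A 0 (1 + 1))
      (blockEntry A (1 + 1) (1 + 1)) (blockEntry A (1 + 1) 1) r (P i j)

/-- The meaning of `pfaffian`. -/
def IsPfaffian (N : M.Num) (A : BitMatrix M) (z : BitSet M) : Prop :=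
  ∃ Q, matEntry Q N 0 = oneBits ∧
    (∀ k d, k + d + 1 = N → ∃ P, IsPBMatrix d (blockEntry A (k + k) (k + k)) (matEntry P) ∧
      IsMatProd (d + 1 + 1) (d + 1) 1 (matEntry P) (fun j _ => matEntry Q (k + 1) j)
        (fun i _ => matEntry Q k i)) ∧
    matEntry Q 0 N = z

/-- The meaning of `isBlockIdentity`. -/
def IsBlockIdentity (N : M.Num) (A : BitMatrix M) : Prop :=
  ∀ a b, a < N + N → b < N + N → (b = a + N → A a b = oneBits) ∧
    (a = b + N → A a b = negOneBits) ∧ (¬ b = a + N ∧ ¬ a = b + N → A a b = zeroBits)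

/-- The meaning of `isNegOnePow`. -/
def IsNegOnePow (n : M.Num) (z : BitSet M) : Prop :=
  (∃ t, n = t + t) ∧ z = oneBits ∨ (∃ t, n = t + t + 1) ∧ z = negOneBits

section Sat
variable {e : ℕ → M.Num} {E : ℕ → M.Str}

omit [IsModel M] in
theorem sat_xor {φ ψ : Formula} :
    (φ.xor ψ).Sat M e E ↔ ¬ (φ.Sat M e E ↔ ψ.Sat M e E) :=
  not_congr sat_iff

theorem sat_lt {s t : NTerm} : (Formula.lt s t).Sat M e E ↔ s.eval M e E < t.eval M e E :=
  (lt_iff_le_and_ne (a := s.eval M e E) (b := t.eval M e E)).symm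

omit [IsModel M]

theorem eval_add {s t : NTerm} : (s + t).eval M e E = s.eval M e E + t.eval M e E := rfl

theorem eval_zero : (0 : NTerm).eval M e E = 0 := rfl

theorem eval_one : (1 : NTerm).eval M e E = 1 := rfl

theorem eval_var {x : ℕ} : (NTerm.var x).eval M e E = e x := rfl

theorem sat_bits {X : ℕ} {i : NTerm} : (bits X i).Sat M e E ↔ M.mem (i.eval M e E) (E X) :=
  Iff.rfl

theorem sat_row {W : ℕ} {l i : NTerm} :
    (row W l i).Sat M e E ↔ rowBits (E W) (l.eval M e E) (i.eval M e E) :=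
  Iff.rfl

theorem sat_mat {X : ℕ} {a b i : NTerm} :
    (mat X a b i).Sat M e E ↔ matEntry (E X) (a.eval M e E) (b.eval M e E) (i.eval M e E) :=
  Iff.rfl

theorem sat_mats {P : ℕ} {k a b i : NTerm} : (mats P k a b i).Sat M e E ↔
    matsEntry (E P) (k.eval M e E) (a.eval M e E) (b.eval M e E) (i.eval M e E) :=
  Iff.rfl

end Sat

theorem sat_matrixPowering (e : ℕ → M.Num) (E : ℕ → M.Str) :
    matrixPowering.Sat M e E ↔ ∀ (m n : M.Num) (X : M.Str),
      (∀ a b, a < m → b < m → IsIntCode (matEntry X a b)) →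
        ∃ Y, IsMatPow m (matEntry X) n (matEntry Y) := by
  simp only [matrixPowering, allNum, exNum, allStr, exStr, isMat, matPow,
    isId, eqMat, matMul, dot, isOne, isZero, emptyBits, eqBits, intMul, intAdd, natMul, natAdd,
    shift, carry, isInt, nonzero, sign, mag,
    Formula.Sat, sat_imp, sat_iff, sat_xor, sat_lt, sat_mat, sat_mats, sat_row, sat_bits,
    eval_add, eval_zero, eval_one, eval_var, Function.update_apply, Nat.reduceEqDiff,
    OfNat.ofNat_ne_zero, OfNat.zero_ne_ofNat, OfNat.ofNat_ne_one, OfNat.one_ne_ofNat, zero_ne_one,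
    ite_true, ite_false,
    IsMatPow, IsIdentity, IsMatProd, IsDot, IsIntProd, IsIntSum, IsIntCode, IsNonzero, magBits,
    IsNatProd, shiftBits, IsNatSum, HasCarry, zeroBits, oneBits,
    funext_iff, eq_iff_iff, iff_false, and_imp, ne_eq]

set_option maxHeartbeats 1600000 in
-- Unfolding the whole sentence exceeds the default limits.
theorem sat_pfBlockIdentity (e : ℕ → M.Num) (E : ℕ → M.Str) :
    pfBlockIdentity.Sat M e E ↔ ∀ n : M.Num, (∃ A, IsBlockIdentity (n + n) (matEntry A)) ∧
      ∀ A, IsBlockIdentity (n + n) (matEntry A) →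
        (∃ Z, IsPfaffian (n + n) (matEntry A) (M.mem · Z)) ∧
        ∀ Z, IsPfaffian (n + n) (matEntry A) (M.mem · Z) → IsNegOnePow n (M.mem · Z) := by
  simp (maxSteps := 1000000) only [pfBlockIdentity, allNum, exNum, allStr, exStr,
    isBlockIdentity, isNegOnePow, pfaffian, isPBMatrix, pbCoeff, isJ, matPow, isId, eqMat, matMul,
    dot, block, isOne, isNegOne, isZero, emptyBits, eqBits, intMul, intAdd, natMul, natAdd, shift,
    carry, isInt, nonzero, sign, mag,
    Formula.Sat, sat_imp, sat_iff, sat_xor, sat_lt, sat_mat, sat_mats, sat_row, sat_bits,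
    eval_add, eval_zero, eval_one, eval_var, Function.update_apply, Nat.reduceEqDiff,
    OfNat.ofNat_ne_zero, OfNat.zero_ne_ofNat, OfNat.ofNat_ne_one, OfNat.one_ne_ofNat, zero_ne_one,
    ite_true, ite_false,
    IsBlockIdentity, IsNegOnePow, IsPfaffian, IsPBMatrix, IsPBCoeff, IsSymplecticJ, IsUpper,
    IsMatPow, IsIdentity, IsMatProd, IsDot, blockEntry, IsIntProd, IsIntSum, IsIntCode, IsNonzero,
    magBits, IsNatProd, shiftBits, IsNatSum, HasCarry, zeroBits, oneBits, negOneBits,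
    funext_iff, eq_iff_iff, iff_false, and_imp, ne_eq]

end Semantics

section Coding
variable {M : Model.{u, v}} [IsModel M]

theorem mem_lt_len {i : M.Num} {X : M.Str} (h : M.mem i X) : i < M.len X :=
  lt_iff_le_and_ne.2 (basicAxioms.lt_len_of_mem i X h)

instance (f g : (ℕ → M.Num) → M.Num) [TermDefinable f] [TermDefinable g] :
    TermDefinable fun e => pairNum (f e) (g e) := by
  unfold pairNum; infer_instance

theorem pairNum_le_pairNum {a b c d : M.Num} (hac : a ≤ c) (hbd : b ≤ d) :
    pairNum a b ≤ pairNum c d := by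
  unfold pairNum; gcongr

theorem le_pairNum_right (a b : M.Num) : b ≤ pairNum a b :=
  le_iff_exists_add.2 ⟨(a + b) * (a + b) + a + (1 + 1) * b, by unfold pairNum; ring⟩

theorem pairNum_lt_pairNum_of_add_lt {a b c d : M.Num} (h : a + b < c + d) :
    pairNum a b < pairNum c d :=
  calc
    pairNum a b < pairNum a b + (2 * a + 2) := lt_add_of_pos_right _ (by positivity)
    _ = (a + b + 1) * (a + b + 1 + 1) := by unfold pairNum; ring
    _ ≤ (c + d) * (c + d + 1) := by have := num_succ_le_iff.2 h; gcongr
    _ ≤ pairNum c d := le_self_add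

theorem pairNum_inj {a b c d : M.Num} : pairNum a b = pairNum c d ↔ a = c ∧ b = d := by
  refine ⟨fun h => ?_, fun h => by rw [h.1, h.2]⟩
  have add_eq : a + b = c + d :=
    le_antisymm (not_lt.1 fun hlt => (pairNum_lt_pairNum_of_add_lt hlt).ne' h)
      (not_lt.1 fun hlt => (pairNum_lt_pairNum_of_add_lt hlt).ne h)
  have double_eq : (1 + 1) * b = (1 + 1) * d := by
    rw [pairNum, pairNum, add_eq] at h
    exact add_left_cancel h
  obtain rfl : b = d := mul_left_cancel₀ (by positivity) double_eq
  exact ⟨add_right_cancel add_eq, rfl⟩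

/-- The set of positions is the set of elements of a string. It is a class so that instance search
proves it. -/
class Coded (b : BitSet M) : Prop where
  exists_str : ∃ X, ∀ i, M.mem i X ↔ b i

theorem Coded.of_bounded {b : BitSet M} [SigmaB0Definable fun e => b (e 0)] (s : M.Num)
    (hs : ∀ i, b i → i < s) : Coded b := by
  obtain ⟨X, len_le, mem_iff⟩ := exists_str_mem_iff b s
  have mem_iff_of_lt {i : M.Num} (hi : i < s) : M.mem i X ↔ b i := mem_iff i ⟨hi.le, hi.ne⟩
  exact ⟨X, fun i => ⟨fun hi => (mem_iff_of_lt ((mem_lt_len hi).trans_le len_le)).1 hi,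
    fun hi => (mem_iff_of_lt (hs i hi)).2 hi⟩⟩

omit [IsModel M] in
theorem Coded.exists_eq (b : BitSet M) [h : Coded b] : ∃ X, b = (M.mem · X) :=
  let ⟨X, hX⟩ := h.exists_str
  ⟨X, funext fun i => propext (hX i).symm⟩

theorem Coded.bounded (b : BitSet M) [Coded b] : ∃ s, ∀ i, b i → i < s := by
  obtain ⟨X, rfl⟩ := exists_eq b
  exact ⟨M.len X, fun _ => mem_lt_len⟩

theorem Coded.exists_max {b : BitSet M} [Coded b] {i : M.Num} (hi : b i) :
    ∃ k, b k ∧ ∀ j, b j → j ≤ k := by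
  obtain ⟨X, rfl⟩ := exists_eq b
  obtain h | ⟨k, hk⟩ := num_eq_zero_or_eq_succ (M.len X)
  · exact absurd (mem_lt_len hi) (h ▸ not_lt_zero)
  · exact ⟨k, basicAxioms.mem_of_succ_eq_len k X hk.symm, fun j hj =>
      num_lt_succ_iff.1 (hk ▸ mem_lt_len hj)⟩

instance (b : BitSet M) [Coded b] (f : (ℕ → M.Num) → M.Num) [TermDefinable f] :
    SigmaB0Definable fun e => b (f e) := by
  obtain ⟨X, rfl⟩ := Coded.exists_eq b
  infer_instance

instance (b c : BitSet M) [Coded b] [Coded c] : Coded fun i => b i ∨ c i := by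
  obtain ⟨s, hs⟩ := Coded.bounded b
  obtain ⟨t, ht⟩ := Coded.bounded c
  exact .of_bounded (max s t) fun i =>
    Or.rec (fun h => lt_max_of_lt_left (hs i h)) fun h => lt_max_of_lt_right (ht i h)

instance : Coded (zeroBits (M := M)) := .of_bounded (b := fun _ => False) 0 fun _ => False.elim

instance : Coded (oneBits (M := M)) := .of_bounded (b := fun i => i = 1) (1 + 1) fun _ hi =>
  num_lt_succ_iff.2 hi.le

instance : Coded (negOneBits (M := M)) :=
  .of_bounded (b := fun i => i = 0 ∨ i = 1) (1 + 1) fun _ hi =>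
    num_lt_succ_iff.2 (hi.elim (fun h => h ▸ zero_le) fun h => h.le)

instance (W : M.Str) (f g : (ℕ → M.Num) → M.Num) [TermDefinable f] [TermDefinable g] :
    SigmaB0Definable fun e => rowBits W (f e) (g e) := by
  unfold rowBits; infer_instance

theorem lt_len_of_rowBits {W : M.Str} {l i : M.Num} (h : rowBits W l i) : i < M.len W :=
  (le_pairNum_right l i).trans_lt (mem_lt_len h)

instance (W : M.Str) (l : M.Num) : Coded (rowBits W l) :=
  .of_bounded (M.len W) fun _ => lt_len_of_rowBits

instance (W : M.Str) (a b : M.Num) : Coded (matEntry W a b) :=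
  inferInstanceAs (Coded (rowBits W (pairNum a b)))

instance (W : M.Str) (f g h : (ℕ → M.Num) → M.Num) [TermDefinable f] [TermDefinable g]
    [TermDefinable h] : SigmaB0Definable fun e => matEntry W (f e) (g e) (h e) :=
  inferInstanceAs (SigmaB0Definable fun e => rowBits W (pairNum (f e) (g e)) (h e))

instance (W : M.Str) (k a b : M.Num) : Coded (matsEntry W k a b) :=
  inferInstanceAs (Coded (rowBits W (pairNum (pairNum k a) b)))

instance (W : M.Str) (k f g h : (ℕ → M.Num) → M.Num) [TermDefinable k] [TermDefinable f]
    [TermDefinable g] [TermDefinable h] :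
    SigmaB0Definable fun e => matsEntry W (k e) (f e) (g e) (h e) :=
  inferInstanceAs
    (SigmaB0Definable fun e => rowBits W (pairNum (pairNum (k e) (f e)) (g e)) (h e))

theorem SigmaB0Definable.bitSet_eq {B C : (ℕ → M.Num) → BitSet M} (s : M.Num)
    (hB : ∀ e i, B e i → i < s) (hC : ∀ e i, C e i → i < s)
    [SigmaB0Definable fun e => B (fun i => e (i + 1)) (e 0)]
    [SigmaB0Definable fun e => C (fun i => e (i + 1)) (e 0)] :
    SigmaB0Definable fun e => B e = C e :=
  .congr (S := fun e => ∀ i, i < s → (B e i ↔ C e i)) inferInstance fun e =>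
    ⟨fun h _ _ => h ▸ Iff.rfl, fun h => funext fun i => propext
      ⟨fun hi => (h i (hB e i hi)).1 hi, fun hi => (h i (hC e i hi)).2 hi⟩⟩

instance (W : M.Str) (f : (ℕ → M.Num) → M.Num) [hf : TermDefinable f] (c : BitSet M) [Coded c] :
    SigmaB0Definable fun e => rowBits W (f e) = c := by
  have := hf.shift
  obtain ⟨t, ht⟩ := Coded.bounded c
  exact .bitSet_eq (max (M.len W) t) (fun _ _ h => lt_max_of_lt_left (lt_len_of_rowBits h))
    fun _ _ h => lt_max_of_lt_right (ht _ h)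

instance (W : M.Str) (f g : (ℕ → M.Num) → M.Num) [TermDefinable f] [TermDefinable g]
    (c : BitSet M) [Coded c] : SigmaB0Definable fun e => matEntry W (f e) (g e) = c :=
  inferInstanceAs (SigmaB0Definable fun e => rowBits W (pairNum (f e) (g e)) = c)

instance (W : M.Str) (k f g : (ℕ → M.Num) → M.Num) [TermDefinable k] [TermDefinable f]
    [TermDefinable g] (c : BitSet M) [Coded c] :
    SigmaB0Definable fun e => matsEntry W (k e) (f e) (g e) = c :=
  inferInstanceAs (SigmaB0Definable fun e => rowBits W (pairNum (pairNum (k e) (f e)) (g e)) = c)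

instance (W V : M.Str) (f g : (ℕ → M.Num) → M.Num) [hf : TermDefinable f]
    [hg : TermDefinable g] : SigmaB0Definable fun e => rowBits W (f e) = rowBits V (g e) := by
  have := hf.shift
  have := hg.shift
  exact .bitSet_eq (max (M.len W) (M.len V))
    (fun _ _ h => lt_max_of_lt_left (lt_len_of_rowBits h))
    fun _ _ h => lt_max_of_lt_right (lt_len_of_rowBits h)

theorem exists_str_rowBits_eq (F : M.Num → BitSet M) [SigmaB0Definable fun e => F (e 1) (e 0)]
    (q s : M.Num) (hs : ∀ l < q, ∀ i, F l i → i < s) : ∃ W, ∀ l < q, rowBits W l = F l := by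
  obtain ⟨W, mem_iff⟩ := (Coded.of_bounded
    (b := fun x => ∃ l, l < q ∧ ∃ i, i < s ∧ x = pairNum l i ∧ F l i) (pairNum q s + 1) (by
      rintro _ ⟨l, hl, i, hi, rfl, -⟩
      exact num_lt_succ_iff.2 (pairNum_le_pairNum hl.le hi.le))).exists_str
  refine ⟨W, fun l hl => funext fun i => propext ((mem_iff _).trans ⟨?_, fun h => ?_⟩)⟩
  · rintro ⟨_, -, _, -, h, hF⟩
    obtain ⟨rfl, rfl⟩ := pairNum_inj.1 h
    exact hF
  · exact ⟨l, hl, i, hs l hl i h, rfl, h⟩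

theorem exists_str_matEntry_eq (F : BitMatrix M) [SigmaB0Definable fun e => F (e 2) (e 1) (e 0)]
    (p q s : M.Num) (hs : ∀ a b, a < p → b < q → ∀ i, F a b i → i < s) :
    ∃ W, ∀ a b, a < p → b < q → matEntry W a b = F a b := by
  obtain ⟨W, mem_iff⟩ := (Coded.of_bounded
    (b := fun x => ∃ a, a < p ∧ ∃ b, b < q ∧ ∃ i, i < s ∧ x = pairNum (pairNum a b) i ∧ F a b i)
    (pairNum (pairNum p q) s + 1) (by
      rintro _ ⟨a, ha, b, hb, i, hi, rfl, -⟩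
      exact num_lt_succ_iff.2
        (pairNum_le_pairNum (pairNum_le_pairNum ha.le hb.le) hi.le))).exists_str
  refine ⟨W, fun a b ha hb => funext fun i => propext ((mem_iff _).trans ⟨?_, fun h => ?_⟩)⟩
  · rintro ⟨_, -, _, -, _, -, h, hF⟩
    obtain ⟨entry_eq, rfl⟩ := pairNum_inj.1 h
    obtain ⟨rfl, rfl⟩ := pairNum_inj.1 entry_eq
    exact hF
  · exact ⟨a, ha, b, hb, i, hs a b ha hb i h, rfl, h⟩

end Coding

section IntegerArithmetic
variable {M : Model.{u, v}} [IsModel M]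

omit [IsModel M] in
theorem eq_zeroBits_iff {b : BitSet M} : b = zeroBits ↔ ∀ i, ¬ b i := by
  simp only [funext_iff, zeroBits, eq_iff_iff, iff_false]

theorem isNatSum_iff_of_disjoint {b c d : BitSet M} (h : ∀ i, b i → ¬ c i) :
    IsNatSum b c d ↔ d = fun i => b i ∨ c i := by
  have not_hasCarry (i : M.Num) : ¬ HasCarry b c i := fun ⟨k, _, hb, hc, _⟩ => h k hb hc
  simp only [IsNatSum, funext_iff, eq_iff_iff, not_hasCarry, iff_false, not_not]
  exact forall_congr' fun i => by have := h i; tauto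

theorem isNatSum_zeroBits_left {c d : BitSet M} : IsNatSum zeroBits c d ↔ d = c := by
  rw [isNatSum_iff_of_disjoint (b := zeroBits) fun _ => False.elim]
  simp only [zeroBits, false_or]

theorem isNatSum_zeroBits_right {c d : BitSet M} : IsNatSum c zeroBits d ↔ d = c := by
  rw [isNatSum_iff_of_disjoint (c := zeroBits) fun _ _ => id]
  simp only [zeroBits, or_false]

/-- If `k` is the last position of `b` or `c`, then position `k` or, because of a carry, position
`k + 1` is in the sum. -/
theorem eq_zeroBits_of_isNatSum {b c : BitSet M} [Coded b] [Coded c]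
    (h : IsNatSum b c zeroBits) : b = zeroBits := by
  refine eq_zeroBits_iff.2 fun i hi => ?_
  obtain ⟨k, hk, le_max⟩ := Coded.exists_max (b := fun i => b i ∨ c i) (.inl hi)
  have k_lt : k < k + 1 := num_lt_succ_iff.2 le_rfl
  have carry_iff (i : M.Num) : HasCarry b c i ↔ ¬ (b i ↔ c i) := by
    have := h i
    simp only [zeroBits] at this
    tauto
  have no_carry : ¬ HasCarry b c (k + 1) := by
    rw [carry_iff, not_not]
    exact iff_of_false (fun h => (le_max _ (.inl h)).not_gt k_lt)
      fun h => (le_max _ (.inr h)).not_gt k_lt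
  by_cases hbc : b k ∧ c k
  · exact no_carry ⟨k, k_lt, hbc.1, hbc.2, fun j hkj hj =>
      absurd (num_lt_succ_iff.1 hj) hkj.not_ge⟩
  · obtain ⟨k', hk', hb, hc, propagates⟩ := (carry_iff k).2 (by tauto)
    refine no_carry ⟨k', hk'.trans k_lt, hb, hc, fun j hkj hj => ?_⟩
    obtain hjk | rfl := (num_lt_succ_iff.1 hj).lt_or_eq
    · exact propagates j hkj hjk
    · exact hk

/-- `F l` is the product of `b` with `c` cut off at position `l`. -/
structure IsPartialProduct (b c : BitSet M) (F : M.Num → BitSet M) : Prop where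
  zero : F 0 = zeroBits
  succ_of_mem : ∀ i, c i → ∀ x, IsNatSum (F i) (shiftBits i b) x ↔ x = F (i + 1)
  succ_of_not_mem : ∀ i, ¬ c i → F (i + 1) = F i
  bounded : ∃ s, ∀ l i, F l i → i < s

theorem IsPartialProduct.rowBits_eq {b c : BitSet M} {F : M.Num → BitSet M}
    [SigmaB0Definable fun e => F (e 1) (e 0)] (hF : IsPartialProduct b c F) {W : M.Str} {l : M.Num}
    (row_zero : rowBits W 0 = zeroBits)
    (row_succ : ∀ i < l, (c i → IsNatSum (rowBits W i) (shiftBits i b) (rowBits W (i + 1))) ∧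
      (¬ c i → rowBits W (i + 1) = rowBits W i)) :
    rowBits W l = F l := by
  obtain ⟨s, hs⟩ := hF.bounded
  have : SigmaB0Definable fun e => rowBits W (e 0) = F (e 0) :=
    .bitSet_eq (max (M.len W) s) (fun _ _ h => lt_max_of_lt_left (lt_len_of_rowBits h))
      fun _ _ h => lt_max_of_lt_right (hs _ _ h)
  suffices ∀ i, i ≤ l → rowBits W i = F i from this l le_rfl
  refine num_induction (fun _ => row_zero.trans hF.zero.symm) fun i ih hi => ?_
  have row_eq := ih (num_succ_le_iff.1 hi).le
  obtain ⟨succ_of_mem, succ_of_not_mem⟩ := row_succ i (num_succ_le_iff.1 hi)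
  by_cases hc : c i
  · exact (hF.succ_of_mem i hc _).1 (row_eq ▸ succ_of_mem hc)
  · rw [succ_of_not_mem hc, hF.succ_of_not_mem i hc, row_eq]

theorem IsPartialProduct.isNatProd_iff {b c r : BitSet M} [Coded c] {F : M.Num → BitSet M}
    [SigmaB0Definable fun e => F (e 1) (e 0)] (hF : IsPartialProduct b c F)
    (last : ∀ l, (∀ i, c i → i < l) → F l = r) (d : BitSet M) : IsNatProd b c d ↔ d = r := by
  constructor
  · rintro ⟨l, hl, W, row_zero, row_succ, rfl⟩
    rw [hF.rowBits_eq row_zero row_succ, last l hl]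
  · rintro rfl
    obtain ⟨l, hl⟩ := Coded.bounded c
    obtain ⟨s, hs⟩ := hF.bounded
    obtain ⟨W, row_eq⟩ := exists_str_rowBits_eq F (l + 1) s fun l _ => hs l
    have row_eq {i : M.Num} (hi : i ≤ l) : rowBits W i = F i := row_eq i (num_lt_succ_iff.2 hi)
    refine ⟨l, hl, W, (row_eq zero_le).trans hF.zero, fun i hi => ?_,
      (row_eq le_rfl).trans (last l hl)⟩
    rw [row_eq hi.le, row_eq (num_succ_le_iff.2 hi)]
    exact ⟨fun hc => (hF.succ_of_mem i hc _).2 rfl, hF.succ_of_not_mem i⟩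

/-- The natural number `1` in binary, without a sign position. -/
def unitBits : BitSet M := fun i => i = 0

instance : Coded (unitBits (M := M)) :=
  .of_bounded (b := fun i => i = 0) 1 fun _ hi => hi ▸ zero_lt_one

omit [IsModel M] in
theorem shiftBits_zeroBits (s : M.Num) : shiftBits s zeroBits = zeroBits :=
  eq_zeroBits_iff.2 fun _ ⟨_, _, h⟩ => h

theorem shiftBits_unitBits (s : M.Num) : shiftBits s unitBits = fun i => i = s := by
  funext i
  simp [shiftBits, unitBits, eq_comm]

theorem shiftBits_zero (b : BitSet M) : shiftBits 0 b = b := by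
  funext i
  simp [shiftBits]

theorem isNatProd_zeroBits_left (c d : BitSet M) [Coded c] :
    IsNatProd zeroBits c d ↔ d = zeroBits :=
  IsPartialProduct.isNatProd_iff (F := fun _ _ => False)
    { zero := rfl
      succ_of_mem := fun i _ x => by rw [shiftBits_zeroBits]; exact isNatSum_zeroBits_left
      succ_of_not_mem := fun _ _ => rfl
      bounded := ⟨0, fun _ _ => False.elim⟩ } (fun _ _ => rfl) d

theorem isNatProd_zeroBits_right (b d : BitSet M) : IsNatProd b zeroBits d ↔ d = zeroBits :=
  IsPartialProduct.isNatProd_iff (c := zeroBits) (F := fun _ _ => False)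
    { zero := rfl
      succ_of_mem := fun _ => False.elim
      succ_of_not_mem := fun _ _ => rfl
      bounded := ⟨0, fun _ _ => False.elim⟩ } (fun _ _ => rfl) d

theorem isNatProd_unitBits_left (c d : BitSet M) [Coded c] : IsNatProd unitBits c d ↔ d = c := by
  refine IsPartialProduct.isNatProd_iff (F := fun l i => i < l ∧ c i)
    { zero := eq_zeroBits_iff.2 fun i h => not_lt_zero h.1
      succ_of_mem := fun i hi x => ?_
      succ_of_not_mem := fun i hi => ?_
      bounded := (Coded.bounded c).imp fun s hs _ i h => hs i h.2 }
    (fun l hl => funext fun i => propext ⟨And.right, fun h => ⟨hl i h, h⟩⟩) d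
  · rw [shiftBits_unitBits, isNatSum_iff_of_disjoint fun j hj => hj.1.ne]
    refine Eq.congr_right (funext fun j => propext ?_)
    rw [num_lt_succ_iff, le_iff_lt_or_eq, or_and_right, and_iff_left_of_imp (a := j = i)]
    exact fun h => h ▸ hi
  · funext j
    rw [num_lt_succ_iff, le_iff_lt_or_eq, or_and_right, or_iff_left]
    exact fun h => hi (h.1 ▸ h.2)

theorem isNatProd_unitBits_right (b d : BitSet M) [Coded b] : IsNatProd b unitBits d ↔ d = b := by
  refine IsPartialProduct.isNatProd_iff (c := unitBits) (F := fun l i => 0 < l ∧ b i)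
    { zero := eq_zeroBits_iff.2 fun i h => lt_irrefl _ h.1
      succ_of_mem := fun i hi x => ?_
      succ_of_not_mem := fun i hi => ?_
      bounded := (Coded.bounded b).imp fun s hs _ i h => hs i h.2 }
    (fun l hl => funext fun i => propext ⟨And.right, fun h => ⟨hl 0 rfl, h⟩⟩) d
  · obtain rfl : i = 0 := hi
    simp only [shiftBits_zero, lt_irrefl, false_and, zero_add, zero_lt_one, true_and]
    exact isNatSum_zeroBits_left
  · funext j
    simp only [pos_of_ne_zero (show i ≠ 0 from hi), add_pos_of_pos_of_nonneg, zero_le, true_and]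

omit [IsModel M] in
theorem magBits_zeroBits : magBits zeroBits = (zeroBits : BitSet M) := rfl

theorem magBits_oneBits : magBits oneBits = (unitBits : BitSet M) := by
  funext i
  simp [magBits, oneBits, unitBits]

theorem magBits_negOneBits : magBits negOneBits = (unitBits : BitSet M) := by
  funext i
  simp [magBits, negOneBits, unitBits]

instance (b : BitSet M) [Coded b] : Coded (magBits b) := by
  obtain ⟨s, hs⟩ := Coded.bounded b
  exact .of_bounded (b := fun i => b (i + 1)) s fun i hi => num_succ_le_iff.1 (hs _ hi).le

omit [IsModel M] in
theorem isNonzero_iff {b : BitSet M} : IsNonzero b ↔ magBits b ≠ zeroBits := by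
  simp only [IsNonzero, ne_eq, eq_zeroBits_iff, not_forall, not_not]

theorem bitSet_ext {b c : BitSet M} (sign_iff : b 0 ↔ c 0) (mag_eq : magBits b = magBits c) :
    b = c := by
  funext i
  obtain rfl | ⟨i, rfl⟩ := num_eq_zero_or_eq_succ i
  · exact propext sign_iff
  · exact congrFun mag_eq i

theorem IsIntCode.ext {b c : BitSet M} (hb : IsIntCode b) (hc : IsIntCode c)
    (sign_iff : IsNonzero b → (b 0 ↔ c 0)) (mag_eq : magBits b = magBits c) : b = c := by
  refine bitSet_ext ?_ mag_eq
  have nonzero_iff : IsNonzero b ↔ IsNonzero c := by rw [isNonzero_iff, mag_eq, isNonzero_iff]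
  exact ⟨fun h => (sign_iff (hb h)).1 h, fun h => (sign_iff (nonzero_iff.2 (hc h))).2 h⟩

/-- The code of the negative of an integer; `0` keeps the sign `+`. -/
def negBits (b : BitSet M) : BitSet M := fun i => i = 0 ∧ ¬ b 0 ∧ IsNonzero b ∨ i ≠ 0 ∧ b i

instance (b : BitSet M) [Coded b] : Coded (negBits b) := by
  obtain ⟨s, hs⟩ := Coded.bounded b
  exact .of_bounded (b := fun i => i = 0 ∧ ¬ b 0 ∧ IsNonzero b ∨ i ≠ 0 ∧ b i) (s + 1)
    fun i hi => num_lt_succ_iff.2 (hi.elim (fun h => h.1 ▸ zero_le) fun h => (hs i h.2).le)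

instance (W : M.Str) (f g h : (ℕ → M.Num) → M.Num) [hf : TermDefinable f]
    [hg : TermDefinable g] [TermDefinable h] :
    SigmaB0Definable fun e => negBits (matEntry W (f e) (g e)) (h e) := by
  have := hf.shift
  have := hg.shift
  have bounded : SigmaB0Definable (M := M) fun e =>
    ∃ i, i ≤ M.len W ∧ matEntry W (f e) (g e) (i + 1) := inferInstance
  have : SigmaB0Definable fun e => IsNonzero (matEntry W (f e) (g e)) :=
    bounded.congr fun e => exists_congr fun i => (and_iff_right_of_imp fun h =>
      ((lt_add_one i).trans (lt_len_of_rowBits h)).le).symm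
  unfold negBits; infer_instance

theorem magBits_negBits (b : BitSet M) : magBits (negBits b) = magBits b := by
  funext i
  simp [magBits, negBits]

omit [IsModel M] in
theorem negBits_zero_iff {b : BitSet M} : negBits b 0 ↔ ¬ b 0 ∧ IsNonzero b := by
  simp [negBits]

theorem isNonzero_negBits {b : BitSet M} : IsNonzero (negBits b) ↔ IsNonzero b := by
  rw [isNonzero_iff, magBits_negBits, isNonzero_iff]

theorem isIntCode_negBits (b : BitSet M) : IsIntCode (negBits b) := fun h =>
  isNonzero_negBits.2 (negBits_zero_iff.1 h).2

omit [IsModel M] in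
theorem isIntCode_zeroBits : IsIntCode (zeroBits : BitSet M) := False.elim

theorem isIntCode_oneBits : IsIntCode (oneBits : BitSet M) := fun _ => ⟨0, zero_add 1⟩

theorem isIntCode_negOneBits : IsIntCode (negOneBits : BitSet M) := fun _ => ⟨0, .inr (zero_add 1)⟩

theorem not_oneBits_zero : ¬ (oneBits : BitSet M) 0 := zero_ne_one (α := M.Num)

omit [IsModel M] in
theorem negOneBits_zero : (negOneBits : BitSet M) 0 := .inl rfl

theorem negBits_zeroBits : negBits zeroBits = (zeroBits : BitSet M) :=
  bitSet_ext (negBits_zero_iff.trans (iff_of_false (fun ⟨_, _, h⟩ => h) id)) (magBits_negBits _)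

theorem negBits_oneBits : negBits oneBits = (negOneBits : BitSet M) :=
  bitSet_ext (negBits_zero_iff.trans
    (iff_of_true ⟨not_oneBits_zero, 0, zero_add 1⟩ negOneBits_zero))
    (by rw [magBits_negBits, magBits_oneBits, magBits_negOneBits])

theorem negBits_negOneBits : negBits negOneBits = (oneBits : BitSet M) :=
  bitSet_ext (negBits_zero_iff.trans
    (iff_of_false (fun h => h.1 negOneBits_zero) not_oneBits_zero))
    (by rw [magBits_negBits, magBits_oneBits, magBits_negOneBits])

theorem isIntSum_zeroBits_left {c d : BitSet M} [Coded c] [Coded d] (hc : IsIntCode c) :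
    IsIntSum zeroBits c d ↔ d = c := by
  simp only [IsIntSum, magBits_zeroBits, isNatSum_zeroBits_left]
  have zero_nonneg : ¬ zeroBits (0 : M.Num) := id
  constructor
  · rintro ⟨-, ⟨sign_c, sign_d, mag_eq⟩ | ⟨sign_c, ⟨-, sum_eq⟩ | ⟨sign_d, mag_eq⟩⟩⟩
    · exact bitSet_ext (sign_d.trans sign_c) mag_eq
    · exact absurd (eq_zeroBits_of_isNatSum sum_eq) (isNonzero_iff.1 (hc (by tauto)))
    · exact bitSet_ext sign_d mag_eq.symm
  · rintro rfl
    refine ⟨hc, ?_⟩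
    by_cases h0 : d 0
    · exact .inr ⟨by tauto, .inr ⟨Iff.rfl, rfl⟩⟩
    · exact .inl ⟨by tauto, by tauto, rfl⟩

theorem isIntSum_zeroBits_right {c d : BitSet M} [Coded c] [Coded d] (hc : IsIntCode c) :
    IsIntSum c zeroBits d ↔ d = c := by
  simp only [IsIntSum, magBits_zeroBits, isNatSum_zeroBits_left, isNatSum_zeroBits_right]
  have zero_nonneg : ¬ zeroBits (0 : M.Num) := id
  constructor
  · rintro ⟨-, ⟨-, sign_d, mag_eq⟩ | ⟨sign_c, ⟨sign_d, mag_eq⟩ | ⟨-, sum_eq⟩⟩⟩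
    · exact bitSet_ext sign_d mag_eq
    · exact bitSet_ext sign_d mag_eq.symm
    · exact absurd (eq_zeroBits_of_isNatSum sum_eq) (isNonzero_iff.1 (hc (by tauto)))
  · rintro rfl
    refine ⟨hc, ?_⟩
    by_cases h0 : d 0
    · exact .inr ⟨by tauto, .inl ⟨Iff.rfl, rfl⟩⟩
    · exact .inl ⟨by tauto, by tauto, rfl⟩

/-- `w` is the only integer that satisfies `intMul` as a product of `b` and `c`. -/
def ProdEq (b c w : BitSet M) : Prop := ∀ d, IsIntProd b c d ↔ d = w

theorem IsIntCode.prodEq {b c w : BitSet M} (hw : IsIntCode w)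
    (natProd_iff : ∀ x, IsNatProd (magBits b) (magBits c) x ↔ x = magBits w)
    (sign_iff : IsNonzero w → (w 0 ↔ ¬ (b 0 ↔ c 0))) : ProdEq b c w := by
  intro d
  simp only [IsIntProd, natProd_iff]
  constructor
  · rintro ⟨hd, mag_eq, sign_iff_d⟩
    have nonzero_iff : IsNonzero d ↔ IsNonzero w := by rw [isNonzero_iff, mag_eq, isNonzero_iff]
    exact hd.ext hw (fun h => (sign_iff_d h).trans (sign_iff (nonzero_iff.1 h)).symm) mag_eq
  · rintro rfl
    exact ⟨hw, rfl, sign_iff⟩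

theorem prodEq_zeroBits_left (c : BitSet M) [Coded c] : ProdEq zeroBits c zeroBits :=
  isIntCode_zeroBits.prodEq (fun _ => isNatProd_zeroBits_left _ _) fun ⟨_, h⟩ => h.elim

theorem prodEq_zeroBits_right (b : BitSet M) : ProdEq b zeroBits zeroBits :=
  isIntCode_zeroBits.prodEq (fun _ => isNatProd_zeroBits_right _ _) fun ⟨_, h⟩ => h.elim

theorem prodEq_oneBits_left {c : BitSet M} [Coded c] (hc : IsIntCode c) : ProdEq oneBits c c :=
  hc.prodEq (fun x => by rw [magBits_oneBits]; exact isNatProd_unitBits_left _ x)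
    fun _ => by have := not_oneBits_zero (M := M); tauto

theorem prodEq_oneBits_right {c : BitSet M} [Coded c] (hc : IsIntCode c) : ProdEq c oneBits c :=
  hc.prodEq (fun x => by rw [magBits_oneBits]; exact isNatProd_unitBits_right _ x)
    fun _ => by have := not_oneBits_zero (M := M); tauto

theorem prodEq_negOneBits_left (c : BitSet M) [Coded c] : ProdEq negOneBits c (negBits c) :=
  (isIntCode_negBits c).prodEq
    (fun x => by rw [magBits_negOneBits, magBits_negBits]; exact isNatProd_unitBits_left _ x)
    fun h => by
      have := negOneBits_zero (M := M)
      have := isNonzero_negBits.1 h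
      rw [negBits_zero_iff]
      tauto

theorem prodEq_negOneBits_right (c : BitSet M) [Coded c] : ProdEq c negOneBits (negBits c) :=
  (isIntCode_negBits c).prodEq
    (fun x => by rw [magBits_negOneBits, magBits_negBits]; exact isNatProd_unitBits_right _ x)
    fun h => by
      have := negOneBits_zero (M := M)
      have := isNonzero_negBits.1 h
      rw [negBits_zero_iff]
      tauto

/-- `1` if `p` holds, `-1` if `q` holds, and `0` if neither does. No value is intended if both
hold. -/
def signBits (p q : Prop) : BitSet M := fun i => p ∧ i = 1 ∨ q ∧ (i = 0 ∨ i = 1)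

omit [IsModel M] in
theorem signBits_eq_negOneBits {p q : Prop} (hq : q) : signBits p q = (negOneBits : BitSet M) := by
  funext i
  simp only [signBits, negOneBits, hq, true_and, eq_iff_iff]
  tauto

omit [IsModel M] in
theorem signBits_eq_oneBits {p q : Prop} (hp : p) (hq : ¬ q) :
    signBits p q = (oneBits : BitSet M) := by
  funext i
  simp [signBits, oneBits, hp, hq]

omit [IsModel M] in
theorem signBits_eq_zeroBits {p q : Prop} (hp : ¬ p) (hq : ¬ q) :
    signBits p q = (zeroBits : BitSet M) := by
  simp [eq_zeroBits_iff, signBits, hp, hq]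

omit [IsModel M] in
theorem signBits_congr {p q p' q' : Prop} (hp : p ↔ p') (hq : q ↔ q') :
    signBits p q = (signBits p' q' : BitSet M) := by
  rw [propext hp, propext hq]

omit [IsModel M] in
theorem eq_signBits_iff {p q : Prop} (not_both : p → ¬ q) {x : BitSet M} :
    x = signBits p q ↔
      (p → x = oneBits) ∧ (q → x = negOneBits) ∧ (¬ p ∧ ¬ q → x = zeroBits) := by
  by_cases hq : q
  · simp [hq, signBits_eq_negOneBits, show ¬ p from fun hp => not_both hp hq]
  by_cases hp : p
  · simp [hp, hq, signBits_eq_oneBits]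
  · simp [hp, hq, signBits_eq_zeroBits]

theorem lt_two_of_signBits {p q : Prop} {i : M.Num} (h : signBits p q i) : i < 1 + 1 :=
  num_lt_succ_iff.2 <| h.elim (fun h => h.2.le) fun h => h.2.elim (fun h => h ▸ zero_le) Eq.le

instance (p q : Prop) : Coded (signBits p q : BitSet M) :=
  .of_bounded (b := fun i => p ∧ i = 1 ∨ q ∧ (i = 0 ∨ i = 1)) (1 + 1) fun _ => lt_two_of_signBits

instance (P Q : (ℕ → M.Num) → Prop) (f : (ℕ → M.Num) → M.Num) [SigmaB0Definable P]
    [SigmaB0Definable Q] [TermDefinable f] :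
    SigmaB0Definable fun e => signBits (P e) (Q e) (f e) := by
  unfold signBits; infer_instance

instance (W : M.Str) (f g : (ℕ → M.Num) → M.Num) (P Q : (ℕ → M.Num) → Prop) [TermDefinable f]
    [TermDefinable g] [SigmaB0Definable P] [SigmaB0Definable Q] :
    SigmaB0Definable fun e => matEntry W (f e) (g e) = signBits (P e) (Q e) :=
  .congr (S := fun e => (Q e → matEntry W (f e) (g e) = negOneBits) ∧
    (¬ Q e → (P e → matEntry W (f e) (g e) = oneBits) ∧
      (¬ P e → matEntry W (f e) (g e) = zeroBits))) inferInstance fun e => by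
    by_cases hQ : Q e
    · simp [hQ, signBits_eq_negOneBits]
    by_cases hP : P e
    · simp [hP, hQ, signBits_eq_oneBits]
    · simp [hP, hQ, signBits_eq_zeroBits]

theorem isIntCode_signBits (p q : Prop) : IsIntCode (signBits p q : BitSet M) := by
  by_cases hq : q
  · exact signBits_eq_negOneBits (M := M) hq ▸ isIntCode_negOneBits
  by_cases hp : p
  · exact signBits_eq_oneBits (M := M) hp hq ▸ isIntCode_oneBits
  · exact signBits_eq_zeroBits (M := M) hp hq ▸ isIntCode_zeroBits

theorem negBits_signBits {p q : Prop} (not_both : p → ¬ q) :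
    negBits (signBits p q) = (signBits q p : BitSet M) := by
  by_cases hq : q
  · have hp : ¬ p := fun hp => not_both hp hq
    rw [signBits_eq_negOneBits hq, signBits_eq_oneBits hq hp, negBits_negOneBits]
  by_cases hp : p
  · rw [signBits_eq_oneBits hp hq, signBits_eq_negOneBits hp, negBits_oneBits]
  · rw [signBits_eq_zeroBits hp hq, signBits_eq_zeroBits hq hp, negBits_zeroBits]

theorem exists_prodEq_signBits (p q : Prop) {c : BitSet M} [Coded c] (hc : IsIntCode c) :
    ∃ w, ProdEq (signBits p q) c w ∧ ProdEq c (signBits p q) w := by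
  by_cases hq : q
  · rw [signBits_eq_negOneBits hq]
    exact ⟨_, prodEq_negOneBits_left c, prodEq_negOneBits_right c⟩
  by_cases hp : p
  · rw [signBits_eq_oneBits hp hq]
    exact ⟨_, prodEq_oneBits_left hc, prodEq_oneBits_right hc⟩
  · rw [signBits_eq_zeroBits hp hq]
    exact ⟨_, prodEq_zeroBits_left c, prodEq_zeroBits_right c⟩

end IntegerArithmetic

section DotProducts
variable {M : Model.{u, v}} [IsModel M] {q a : M.Num} {x y : M.Num → BitSet M} {d w : BitSet M}

theorem IsDot.coded (h : IsDot q x y d) : Coded d := by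
  obtain ⟨T, -, -, rfl⟩ := h
  infer_instance

theorem IsDot.isIntCode (h : IsDot q x y d) : IsIntCode d := by
  obtain ⟨T, row_zero, row_succ, rfl⟩ := h
  obtain rfl | ⟨k, rfl⟩ := num_eq_zero_or_eq_succ q
  · exact row_zero ▸ isIntCode_zeroBits
  · obtain ⟨V, -, isIntSum⟩ := row_succ k (lt_add_one k)
    exact isIntSum.1

theorem isDot_congr {x' y' : M.Num → BitSet M}
    (isIntProd_iff : ∀ l < q, ∀ v, IsIntProd (x l) (y l) v ↔ IsIntProd (x' l) (y' l) v) :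
    IsDot q x y d ↔ IsDot q x' y' d :=
  exists_congr fun _ => and_congr_right fun _ => and_congr_left fun _ =>
    forall₂_congr fun l hl => exists_congr fun _ => and_congr_left fun _ => isIntProd_iff l hl _

theorem isDot_zero_iff : IsDot 0 x y d ↔ d = zeroBits := by
  constructor
  · rintro ⟨T, row_zero, -, rfl⟩
    exact row_zero
  · rintro rfl
    obtain ⟨T, row_eq⟩ := exists_str_rowBits_eq (fun _ => zeroBits (M := M)) 1 0
      fun _ _ _ => False.elim
    have row_zero := row_eq 0 zero_lt_one
    exact ⟨T, row_zero, fun _ h => absurd h not_lt_zero, row_zero⟩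

/-- The partial sums of a dot product can be continued by a constant. -/
theorem exists_str_rowBits_append (T : M.Str) (d : BitSet M) [Coded d] (a q : M.Num) :
    ∃ T', (∀ l ≤ a, rowBits T' l = rowBits T l) ∧ ∀ l, a < l → l ≤ q → rowBits T' l = d := by
  obtain ⟨s, hs⟩ := Coded.bounded d
  obtain ⟨T', row_eq⟩ := exists_str_rowBits_eq
    (fun l i => l ≤ a ∧ rowBits T l i ∨ a < l ∧ d i) (max a q + 1) (max (M.len T) s)
    fun l _ i => Or.rec (fun h => lt_max_of_lt_left (lt_len_of_rowBits h.2))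
      fun h => lt_max_of_lt_right (hs i h.2)
  refine ⟨T', fun l hl => ?_, fun l hl hlq => ?_⟩
  · rw [row_eq l (num_lt_succ_iff.2 (le_max_of_le_left hl))]
    simp only [hl, hl.not_gt, true_and, false_and, or_false]
  · rw [row_eq l (num_lt_succ_iff.2 (le_max_of_le_right hlq))]
    simp only [hl, hl.not_ge, true_and, false_and, false_or]

theorem isDot_iff_of_tail_zero (haq : a ≤ q)
    (tail_zero : ∀ l, a ≤ l → l < q → ProdEq (x l) (y l) zeroBits) :
    IsDot q x y d ↔ IsDot a x y d := by
  constructor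
  · rintro ⟨T, row_zero, row_succ, rfl⟩
    refine ⟨T, row_zero, fun l hl => row_succ l (hl.trans_le haq), ?_⟩
    suffices ∀ l, a ≤ l → l ≤ q → rowBits T l = rowBits T a from (this q haq le_rfl).symm
    refine num_induction (fun h _ => by rw [le_zero_iff.1 h]) fun l ih hal hlq => ?_
    obtain rfl | hal := hal.eq_or_lt
    · rfl
    have hal := num_lt_succ_iff.1 hal
    have hlq := num_succ_le_iff.1 hlq
    obtain ⟨V, isIntProd, isIntSum⟩ := row_succ l hlq
    have isIntCode : IsIntCode (rowBits T l) :=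
      IsDot.isIntCode ⟨T, row_zero, fun k hk => row_succ k (hk.trans hlq), rfl⟩
    rw [(tail_zero l hal hlq _).1 isIntProd] at isIntSum
    exact ((isIntSum_zeroBits_right isIntCode).1 isIntSum).trans (ih hal hlq.le)
  · intro h
    have isIntCode := h.isIntCode
    obtain ⟨T, row_zero, row_succ, rfl⟩ := h
    obtain ⟨T', init_eq, tail_eq⟩ := exists_str_rowBits_append T (rowBits T a) a q
    have tail_eq {l : M.Num} (hal : a ≤ l) (hlq : l ≤ q) : rowBits T' l = rowBits T a := by
      obtain rfl | hal := hal.eq_or_lt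
      · exact init_eq _ le_rfl
      · exact tail_eq l hal hlq
    refine ⟨T', (init_eq 0 zero_le).trans row_zero, fun l hlq => ?_, tail_eq haq le_rfl⟩
    obtain hla | hal := lt_or_ge l a
    · rw [init_eq l hla.le, init_eq (l + 1) (num_succ_le_iff.2 hla)]
      exact row_succ l hla
    · obtain ⟨V, zeroBits_eq⟩ := Coded.exists_eq (zeroBits : BitSet M)
      rw [tail_eq hal hlq.le, tail_eq (hal.trans (lt_add_one l).le) (num_succ_le_iff.2 hlq)]
      refine ⟨V, ?_⟩
      rw [← zeroBits_eq]
      exact ⟨(tail_zero l hal hlq _).2 rfl, (isIntSum_zeroBits_right isIntCode).2 rfl⟩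

theorem isDot_succ_iff [Coded w] [Coded d] (prodEq : ProdEq (x a) (y a) w) :
    IsDot (a + 1) x y d ↔ ∃ C, IsDot a x y (M.mem · C) ∧ IsIntSum (M.mem · C) w d := by
  constructor
  · rintro ⟨T, row_zero, row_succ, rfl⟩
    obtain ⟨C, row_eq⟩ := Coded.exists_eq (rowBits T a)
    refine ⟨C, ⟨T, row_zero, fun l hl => row_succ l (hl.trans (lt_add_one a)), row_eq⟩, ?_⟩
    obtain ⟨V, isIntProd, isIntSum⟩ := row_succ a (lt_add_one a)
    rwa [(prodEq _).1 isIntProd, row_eq] at isIntSum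
  · rintro ⟨C, ⟨T, row_zero, row_succ, row_eq⟩, isIntSum⟩
    obtain ⟨T', init_eq, last_eq⟩ := exists_str_rowBits_append T d a (a + 1)
    have last_eq := last_eq _ (lt_add_one a) le_rfl
    refine ⟨T', (init_eq 0 zero_le).trans row_zero, fun l hl => ?_, last_eq⟩
    rw [init_eq l (num_lt_succ_iff.1 hl)]
    obtain hl | rfl := (num_lt_succ_iff.1 hl).lt_or_eq
    · rw [init_eq (l + 1) (num_succ_le_iff.2 hl)]
      exact row_succ l hl
    · obtain ⟨V, rfl⟩ := Coded.exists_eq w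
      rw [last_eq, row_eq]
      exact ⟨V, (prodEq _).2 rfl, isIntSum⟩

theorem isDot_iff_eq_zeroBits (prodEq : ∀ l < q, ProdEq (x l) (y l) zeroBits) :
    IsDot q x y d ↔ d = zeroBits :=
  (isDot_iff_of_tail_zero zero_le fun l _ => prodEq l).trans isDot_zero_iff

theorem isDot_iff_eq_of_single [Coded w] (haq : a < q) (hw : IsIntCode w)
    (prodEq : ProdEq (x a) (y a) w)
    (prodEq_of_ne : ∀ l < q, l ≠ a → ProdEq (x l) (y l) zeroBits) : IsDot q x y d ↔ d = w := by
  rw [isDot_iff_of_tail_zero (num_succ_le_iff.2 haq) fun l hal hlq =>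
    prodEq_of_ne l hlq (num_succ_le_iff.1 hal).ne']
  have init_iff {c : BitSet M} : IsDot a x y c ↔ c = zeroBits :=
    isDot_iff_eq_zeroBits fun l hl => prodEq_of_ne l (hl.trans haq) hl.ne
  suffices Coded d → (IsDot (a + 1) x y d ↔ d = w) from
    ⟨fun h => (this h.coded).1 h, fun h => (this (h ▸ ‹Coded w›)).2 h⟩
  intro
  rw [isDot_succ_iff prodEq]
  constructor
  · rintro ⟨C, isDot, isIntSum⟩
    rw [init_iff.1 isDot] at isIntSum
    exact (isIntSum_zeroBits_left hw).1 isIntSum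
  · intro h
    obtain ⟨C, zeroBits_eq⟩ := Coded.exists_eq (zeroBits : BitSet M)
    refine ⟨C, init_iff.2 zeroBits_eq.symm, ?_⟩
    rw [← zeroBits_eq]
    exact (isIntSum_zeroBits_left hw).2 h

theorem isDot_unit_left [∀ l, Coded (y l)] (haq : a < q) (hy : IsIntCode (y a))
    (hx : ∀ l < q, x l = signBits (l = a) False) : IsDot q x y d ↔ d = y a := by
  refine isDot_iff_eq_of_single haq hy ?_ fun l hl hla => ?_
  · rw [hx a haq, signBits_eq_oneBits rfl id]
    exact prodEq_oneBits_left hy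
  · rw [hx l hl, signBits_eq_zeroBits hla id]
    exact prodEq_zeroBits_left _

theorem isDot_unit_right [Coded (x a)] (haq : a < q) (ha : IsIntCode (x a))
    (hy : ∀ l < q, y l = signBits (l = a) False) : IsDot q x y d ↔ d = x a := by
  refine isDot_iff_eq_of_single haq ha ?_ fun l hl hla => ?_
  · rw [hy a haq, signBits_eq_oneBits rfl id]
    exact prodEq_oneBits_right ha
  · rw [hy l hl, signBits_eq_zeroBits hla id]
    exact prodEq_zeroBits_right _

theorem isDot_negUnit_right [Coded (x a)] (haq : a < q)
    (hy : ∀ l < q, y l = signBits False (l = a)) : IsDot q x y d ↔ d = negBits (x a) := by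
  refine isDot_iff_eq_of_single haq (isIntCode_negBits _) ?_ fun l hl hla => ?_
  · rw [hy a haq, signBits_eq_negOneBits rfl]
    exact prodEq_negOneBits_right _
  · rw [hy l hl, signBits_eq_zeroBits id hla]
    exact prodEq_zeroBits_right _

end DotProducts

section Parity
variable {M : Model.{u, v}} [IsModel M] {a b s t : M.Num}

theorem double_inj : t + t = s + s ↔ t = s := by
  rw [← two_mul, ← two_mul, mul_right_inj' two_ne_zero]

theorem double_ne_double_add_one : t + t ≠ s + s + 1 := by
  intro h
  obtain hts | hst := le_or_gt t s
  · exact (num_lt_succ_iff.2 (add_le_add hts hts)).ne h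
  · refine (add_lt_add_of_le_of_lt (num_succ_le_iff.2 hst) hst).ne ?_
    rw [h]
    ring

theorem num_even_or_odd (a : M.Num) : (∃ t, a = t + t) ∨ ∃ t, a = t + t + 1 := by
  suffices ∃ t, t < a + 1 ∧ (a = t + t ∨ a = t + t + 1) by
    obtain ⟨t, -, h | h⟩ := this
    exacts [.inl ⟨t, h⟩, .inr ⟨t, h⟩]
  refine num_induction (S := fun a => ∃ t, t < a + 1 ∧ (a = t + t ∨ a = t + t + 1))
    ⟨0, lt_add_one 0, .inl (add_zero 0).symm⟩ ?_ a
  rintro a ⟨t, ht, rfl | rfl⟩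
  · exact ⟨t, ht.trans (lt_add_one _), .inr rfl⟩
  · exact ⟨t + 1, by gcongr, .inl (by ring)⟩

omit [IsModel M] in
theorem isUpper_double_left : IsUpper (t + t) b ↔ b = t + t + 1 :=
  ⟨fun ⟨_, h, hb⟩ => h ▸ hb, fun hb => ⟨t, rfl, hb⟩⟩

theorem isUpper_double_add_one_right : IsUpper a (t + t + 1) ↔ a = t + t :=
  ⟨fun ⟨_, ha, h⟩ => add_right_cancel h ▸ ha, fun ha => ⟨t, ha, rfl⟩⟩

theorem not_isUpper_double_right : ¬ IsUpper a (t + t) :=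
  fun ⟨_, _, h⟩ => double_ne_double_add_one h

theorem not_isUpper_double_add_one_left : ¬ IsUpper (t + t + 1) b :=
  fun ⟨_, h, _⟩ => double_ne_double_add_one h.symm

instance (f g : (ℕ → M.Num) → M.Num) [hf : TermDefinable f] [hg : TermDefinable g] :
    SigmaB0Definable fun e => IsUpper (f e) (g e) := by
  have := hf.shift
  have := hg.shift
  exact .congr (S := fun e => ∃ t, t ≤ f e ∧ (f e = t + t ∧ g e = t + t + 1)) inferInstance
    fun e => exists_congr fun t => (and_iff_right_of_imp fun h => h.1 ▸ le_self_add).symm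

end Parity

section SymplecticForm
variable {M : Model.{u, v}} [IsModel M] {d : M.Num} {J : BitMatrix M} {x : M.Num → BitSet M}

theorem isSymplecticJ_iff {m : M.Num} : IsSymplecticJ m J ↔
    ∀ a b, a < m → b < m → J a b = signBits (IsUpper a b) (IsUpper b a) :=
  forall₄_congr fun _ _ _ _ => Iff.symm <| eq_signBits_iff fun ⟨_, _, hb⟩ =>
    hb ▸ not_isUpper_double_add_one_left

theorem exists_isSymplecticJ (m : M.Num) : ∃ J, IsSymplecticJ m (matEntry J) := by
  simp only [isSymplecticJ_iff]
  exact exists_str_matEntry_eq (fun a b => signBits (IsUpper a b) (IsUpper b a)) m m (1 + 1)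
    fun _ _ _ _ _ => lt_two_of_signBits

/-- The product of a row vector with the matrix `J`. -/
def mulJ (x : M.Num → BitSet M) : M.Num → BitSet M := fun b i =>
  (∃ t, b = t + t + 1 ∧ x (t + t) i) ∨ ∃ t, b = t + t ∧ negBits (x (t + t + 1)) i

theorem mulJ_double (t : M.Num) : mulJ x (t + t) = negBits (x (t + t + 1)) := by
  funext i
  simp only [mulJ, double_ne_double_add_one, double_inj, false_and, exists_false, false_or,
    exists_eq_left']

theorem mulJ_double_add_one (t : M.Num) : mulJ x (t + t + 1) = x (t + t) := by
  funext i
  simp only [mulJ, double_ne_double_add_one.symm, add_left_inj, double_inj, false_and,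
    exists_false, or_false, exists_eq_left']

theorem isDot_symplecticJ_iff {b : M.Num} {z : BitSet M} [∀ l, Coded (x l)]
    (hJ : IsSymplecticJ (d + d) J) (hx : ∀ l < d + d, IsIntCode (x l)) (hb : b < d + d) :
    IsDot (d + d) x (fun l => J l b) z ↔ z = mulJ x b := by
  have column_eq (l : M.Num) (hl : l < d + d) := isSymplecticJ_iff.1 hJ l b hl hb
  obtain ⟨t, rfl⟩ | ⟨t, rfl⟩ := num_even_or_odd b
  · have ht : t + t + 1 < d + d := (num_succ_le_iff.2 hb).lt_of_ne double_ne_double_add_one.symm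
    rw [mulJ_double]
    exact isDot_negUnit_right ht fun l hl => (column_eq l hl).trans <|
      signBits_congr (iff_of_false not_isUpper_double_right id) isUpper_double_left
  · have ht : t + t < d + d := (lt_add_one _).trans hb
    rw [mulJ_double_add_one]
    exact isDot_unit_right ht (hx _ ht) fun l hl => (column_eq l hl).trans <|
      signBits_congr isUpper_double_add_one_right
        (iff_of_false not_isUpper_double_add_one_left id)

theorem isMatProd_symplecticJ_iff {p : M.Num} {A C : BitMatrix M} [∀ a b, Coded (A a b)]
    (hJ : IsSymplecticJ (d + d) J) (hA : ∀ a b, a < p → b < d + d → IsIntCode (A a b)) :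
    IsMatProd p (d + d) (d + d) A J C ↔ ∀ a b, a < p → b < d + d → C a b = mulJ (A a) b :=
  forall₄_congr fun _ _ ha hb => isDot_symplecticJ_iff hJ (fun l hl => hA _ l ha hl) hb

instance (X : M.Str) (s t a b : M.Num) : Coded (blockEntry (matEntry X) s t a b) :=
  inferInstanceAs (Coded (matEntry X (s + a) (t + b)))

theorem lt_len_add_one_of_mulJ {X : M.Str} {s t a b i : M.Num}
    (h : mulJ (blockEntry (matEntry X) s t a) b i) : i < M.len X + 1 := by
  obtain ⟨t, -, h⟩ | ⟨t, -, ⟨rfl, -⟩ | ⟨-, h⟩⟩ := h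
  · exact (lt_len_of_rowBits h).trans (lt_add_one _)
  · exact zero_le.trans_lt (lt_add_one _)
  · exact (lt_len_of_rowBits h).trans (lt_add_one _)

theorem exists_str_mulJ (X : M.Str) (s t p q : M.Num) : ∃ W, ∀ a b, a < p → b < q →
    matEntry W a b = mulJ (blockEntry (matEntry X) s t a) b := by
  have bounded : SigmaB0Definable (M := M) fun e =>
      (∃ r, r ≤ e 1 ∧ e 1 = r + r + 1 ∧ matEntry X (s + e 2) (t + (r + r)) (e 0)) ∨
        ∃ r, r ≤ e 1 ∧ e 1 = r + r ∧ negBits (matEntry X (s + e 2) (t + (r + r + 1))) (e 0) :=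
    inferInstance
  have : SigmaB0Definable fun e => mulJ (blockEntry (matEntry X) s t (e 2)) (e 1) (e 0) :=
    bounded.congr fun e => or_congr
      (exists_congr fun r => (and_iff_right_of_imp fun h =>
        h.1 ▸ le_self_add.trans (lt_add_one _).le).symm)
      (exists_congr fun r => (and_iff_right_of_imp fun h => h.1 ▸ le_self_add).symm)
  exact exists_str_matEntry_eq (fun a b => mulJ (blockEntry (matEntry X) s t a) b) p q
    (M.len X + 1) fun _ _ _ _ _ => lt_len_add_one_of_mulJ

end SymplecticForm

section PBCoefficients
variable {M : Model.{u, v}} [IsModel M] {d m r s t : M.Num} {X : M.Str} {R S : BitMatrix M}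
  {z : BitSet M}

theorem exists_isMatPow (r : M.Num)
    (hX : ∀ a b, a < m → b < m → IsIntCode (matEntry X a b)) :
    ∃ P, IsMatPow m (matEntry X) r (matEntry P) :=
  (sat_matrixPowering (fun _ => 0) fun _ => X).1 (IsModel.models_theory _ (.inr (.inr rfl)) _ _)
    m r X hX

theorem IsMatPow.isIntCode {A P : BitMatrix M} {a b : M.Num} (h : IsMatPow m A r P) (ha : a < m)
    (hb : b < m) : IsIntCode (P a b) := by
  obtain ⟨W, isIdentity, isMatProd, last⟩ := h
  rw [← last a b ha hb]
  obtain rfl | ⟨r, rfl⟩ := num_eq_zero_or_eq_succ r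
  · obtain hab | hab := eq_or_ne a b
    · exact (isIdentity a b ha hb).1 hab ▸ isIntCode_oneBits
    · exact (isIdentity a b ha hb).2 hab ▸ isIntCode_zeroBits
  · exact (isMatProd r (lt_add_one r) a b ha hb).isIntCode

theorem IsMatPow.eq_of_column_zero {A P : BitMatrix M} {a b : M.Num} (h : IsMatPow m A r P)
    (ha : a < m) (hb : b < m) (column_zero : ∀ l < m, A l b = zeroBits) :
    P a b = signBits (r = 0 ∧ a = b) False := by
  obtain ⟨W, isIdentity, isMatProd, last⟩ := h
  rw [← last a b ha hb]
  obtain rfl | ⟨r, rfl⟩ := num_eq_zero_or_eq_succ r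
  · exact (eq_signBits_iff fun _ => id).2 ⟨fun h => (isIdentity a b ha hb).1 h.2, False.elim,
      fun h => (isIdentity a b ha hb).2 fun hab => h.1 ⟨rfl, hab⟩⟩
  · rw [signBits_eq_zeroBits (fun h => (add_pos_of_right zero_lt_one r).ne' h.1) id]
    exact (isDot_iff_eq_zeroBits fun l hl => (column_zero l hl).symm ▸ prodEq_zeroBits_right _).1
      (isMatProd r (lt_add_one r) a b ha hb)

/-- Everything in a PB coefficient that depends only on the middle block exists. -/
theorem exists_isMatPow_mulJ (r : M.Num)
    (hX : ∀ a b, a < d + d → b < d + d → IsIntCode (blockEntry (matEntry X) s t a b)) :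
    ∃ J XJ P, IsSymplecticJ (d + d) (matEntry J) ∧ IsMatProd (d + d) (d + d) (d + d)
      (blockEntry (matEntry X) s t) (matEntry J) (matEntry XJ) ∧
      IsMatPow (d + d) (matEntry XJ) r (matEntry P) := by
  obtain ⟨J, hJ⟩ := exists_isSymplecticJ (d + d)
  obtain ⟨XJ, entry_eq⟩ := exists_str_mulJ X s t (d + d) (d + d)
  have isMatProd := (isMatProd_symplecticJ_iff hJ hX).2 entry_eq
  obtain ⟨P, hP⟩ := exists_isMatPow r fun a b ha hb => (isMatProd a b ha hb).isIntCode
  exact ⟨J, XJ, P, hJ, isMatProd, hP⟩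

theorem isMatProd_one_iff {p q : M.Num} {A B C : BitMatrix M} :
    IsMatProd 1 p q A B C ↔ ∀ b < q, IsDot p (A 0) (fun l => B l b) (C 0 b) := by
  refine ⟨fun h b hb => h 0 b zero_lt_one hb, fun h a b ha hb => ?_⟩
  obtain rfl : a = 0 := le_zero_iff.1 (num_lt_succ_iff.1 (ha.trans_eq (zero_add 1).symm))
  exact h b hb

theorem mulJ_unit {x : M.Num → BitSet M} {b : M.Num} (hb : b < d + d)
    (hx : ∀ l < d + d, x l = signBits (l = s + s) False) :
    mulJ x b = signBits (b = s + s + 1) False := by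
  obtain ⟨t, rfl⟩ | ⟨t, rfl⟩ := num_even_or_odd b
  · rw [mulJ_double, hx _ ((num_succ_le_iff.2 hb).lt_of_ne double_ne_double_add_one.symm),
      signBits_eq_zeroBits double_ne_double_add_one.symm id, negBits_zeroBits,
      signBits_eq_zeroBits double_ne_double_add_one id]
  · rw [mulJ_double_add_one, hx _ ((lt_add_one _).trans hb)]
    exact signBits_congr (add_left_inj 1).symm Iff.rfl

theorem isPBCoeff_iff_of_row_zero [∀ l, Coded (S l 0)]
    (hX : ∀ a b, a < d + d → b < d + d → IsIntCode (blockEntry (matEntry X) s t a b))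
    (hR : ∀ l < d + d, R 0 l = zeroBits) :
    IsPBCoeff (d + d) R (blockEntry (matEntry X) s t) S r z ↔ z = zeroBits := by
  have dot_iff {x y : M.Num → BitSet M} {c : BitSet M} [∀ l, Coded (y l)]
      (hx : ∀ l < d + d, x l = zeroBits) : IsDot (d + d) x y c ↔ c = zeroBits :=
    isDot_iff_eq_zeroBits fun l hl => hx l hl ▸ prodEq_zeroBits_left _
  simp only [IsPBCoeff, isMatProd_one_iff]
  constructor
  · rintro ⟨J, XJ, P, RJ, U, -, -, -, hRJ, hU, hz⟩
    have row_zero (b : M.Num) (hb : b < d + d) := (dot_iff hR).1 (hRJ b hb)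
    exact (dot_iff fun b hb => (dot_iff row_zero).1 (hU b hb)).1 hz
  · rintro rfl
    obtain ⟨J, XJ, P, hJ, hXJ, hP⟩ := exists_isMatPow_mulJ r hX
    obtain ⟨W, hW⟩ := exists_str_matEntry_eq (fun _ _ => zeroBits (M := M)) 1 (d + d) 0
      fun _ _ _ _ _ => False.elim
    have row_zero (b : M.Num) (hb : b < d + d) : matEntry W 0 b = zeroBits :=
      hW 0 b zero_lt_one hb
    exact ⟨J, XJ, P, W, W, hJ, hXJ, hP, fun b hb => (dot_iff hR).2 (row_zero b hb),
      fun b hb => (dot_iff row_zero).2 (row_zero b hb), (dot_iff row_zero).2 rfl⟩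

/-- The row `R J` is the unit vector at `2 s + 1`, so the coefficient is the `(2 s + 1, 2 s + 1)`
entry of `(A J) ^ r` up to sign. Column `2 s + 1` of `A J` is column `2 s` of `A`. -/
theorem isPBCoeff_iff_of_unit [∀ a b, Coded (R a b)] [∀ l, Coded (S l 0)]
    (hX : ∀ a b, a < d + d → b < d + d → IsIntCode (blockEntry (matEntry X) t t a b))
    (hsd : s + s + 1 < d + d) (hR : ∀ l < d + d, R 0 l = signBits (l = s + s) False)
    (hS : ∀ l < d + d, S l 0 = signBits False (l = s + s + 1))
    (column_zero : ∀ a < d + d, blockEntry (matEntry X) t t a (s + s) = zeroBits) :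
    IsPBCoeff (d + d) R (blockEntry (matEntry X) t t) S r z ↔ z = signBits False (r = 0) := by
  have row_iff {J RJ : M.Str} (hJ : IsSymplecticJ (d + d) (matEntry J)) :
      (∀ b < d + d, IsDot (d + d) (R 0) (fun l => matEntry J l b) (matEntry RJ 0 b)) ↔
        ∀ b < d + d, matEntry RJ 0 b = signBits (b = s + s + 1) False :=
    forall₂_congr fun b hb => by
      rw [isDot_symplecticJ_iff hJ (fun l hl => hR l hl ▸ isIntCode_signBits _ _) hb,
        mulJ_unit hb hR]
  have diagonal_eq {J XJ P : M.Str} (hJ : IsSymplecticJ (d + d) (matEntry J))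
      (hXJ : IsMatProd (d + d) (d + d) (d + d) (blockEntry (matEntry X) t t) (matEntry J)
        (matEntry XJ)) (hP : IsMatPow (d + d) (matEntry XJ) r (matEntry P)) :
      negBits (matEntry P (s + s + 1) (s + s + 1)) = signBits False (r = 0) := by
    rw [hP.eq_of_column_zero hsd hsd fun a ha => by
      rw [(isMatProd_symplecticJ_iff hJ hX).1 hXJ a _ ha hsd, mulJ_double_add_one,
        column_zero a ha], negBits_signBits fun _ => id]
    exact signBits_congr Iff.rfl (and_iff_left rfl)
  simp only [IsPBCoeff, isMatProd_one_iff]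
  constructor
  · rintro ⟨J, XJ, P, RJ, U, hJ, hXJ, hP, hRJ, hU, hz⟩
    have unit_row := (row_iff hJ).1 hRJ
    have last_eq := (isDot_unit_left (y := fun l => matEntry P l (s + s + 1)) hsd
      (hP.isIntCode hsd hsd) unit_row).1 (hU _ hsd)
    rw [(isDot_negUnit_right hsd hS).1 hz, last_eq, diagonal_eq hJ hXJ hP]
  · rintro rfl
    obtain ⟨J, XJ, P, hJ, hXJ, hP⟩ := exists_isMatPow_mulJ r hX
    obtain ⟨RJ, hRJ⟩ := exists_str_matEntry_eq (fun _ b => signBits (b = s + s + 1) False)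
      1 (d + d) (1 + 1) fun _ _ _ _ _ => lt_two_of_signBits
    obtain ⟨U, hU⟩ := exists_str_matEntry_eq (fun _ b => matEntry P (s + s + 1) b)
      1 (d + d) (M.len P) fun _ _ _ _ _ => lt_len_of_rowBits
    have unit_row (b : M.Num) (hb : b < d + d) := hRJ 0 b zero_lt_one hb
    have row_eq (b : M.Num) (hb : b < d + d) := hU 0 b zero_lt_one hb
    refine ⟨J, XJ, P, RJ, U, hJ, hXJ, hP, (row_iff hJ).2 unit_row, fun b hb => ?_, ?_⟩
    · exact (isDot_unit_left (y := fun l => matEntry P l b) hsd (hP.isIntCode hsd hb)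
        unit_row).2 (row_eq b hb)
    · rw [isDot_negUnit_right hsd hS, row_eq _ hsd, diagonal_eq hJ hXJ hP]

end PBCoefficients

section PBMatrix
variable {M : Model.{u, v}} [IsModel M] {N d m s t : M.Num} {X : M.Str} {A P : BitMatrix M}

/-- The square matrix `A` of order `m` has the entries `1` on the `N`-th diagonal above the main
one, `-1` on the `N`-th diagonal below it, and `0` elsewhere. The diagonal blocks of
`(0, I; -I, 0)` have this shape. -/
def IsSkewBand (N m : M.Num) (A : BitMatrix M) : Prop :=
  ∀ a b, a < m → b < m → A a b = signBits (b = a + N) (a = b + N)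

theorem isBlockIdentity_iff : IsBlockIdentity N A ↔ IsSkewBand N (N + N) A :=
  forall₄_congr fun a b ha _ => Iff.symm <| eq_signBits_iff fun hb hab => by
    have : a = a + (N + N) := hab.trans (by rw [hb, add_assoc])
    have := left_eq_add.1 this
    exact absurd (this ▸ ha) not_lt_zero

theorem exists_isBlockIdentity (N : M.Num) : ∃ A, IsBlockIdentity N (matEntry A) := by
  simp only [isBlockIdentity_iff]
  exact exists_str_matEntry_eq (fun a b => signBits (b = a + N) (a = b + N)) (N + N) (N + N)
    (1 + 1) fun _ _ _ _ _ => lt_two_of_signBits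

theorem isSkewBand_blockEntry (h : IsSkewBand N (t + m) A) :
    IsSkewBand N m (blockEntry A t t) :=
  fun a b ha hb => (h _ _ (add_lt_add_right ha t) (add_lt_add_right hb t)).trans <|
    signBits_congr (by rw [add_assoc, add_right_inj]) (by rw [add_assoc, add_right_inj])

theorem blockEntry_blockEntry (s t s' t' : M.Num) :
    blockEntry (blockEntry A s t) s' t' = blockEntry A (s + s') (t + t') := by
  funext a b
  simp only [blockEntry, add_assoc]

theorem isPBCoeff_iff_of_isSkewBand {r : M.Num} {z : BitSet M}
    (hX : IsSkewBand (s + s + 1 + 1) (d + d + 1 + 1) (blockEntry (matEntry X) t t))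
    (hds : d ≤ s + s + 1) :
    IsPBCoeff (d + d) (blockEntry (blockEntry (matEntry X) t t) 0 (1 + 1))
      (blockEntry (blockEntry (matEntry X) t t) (1 + 1) (1 + 1))
      (blockEntry (blockEntry (matEntry X) t t) (1 + 1) 1) r z ↔
      z = signBits False (s < d ∧ r = 0) := by
  have entry_eq {a b : M.Num} (ha : a < d + d + 1 + 1) (hb : b < d + d + 1 + 1) :
      matEntry X (t + a) (t + b) = signBits (b = a + (s + s + 1 + 1)) (a = b + (s + s + 1 + 1)) :=
    hX a b ha hb
  have zero_lt_one : (0 : M.Num) < 1 := zero_lt_one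
  have row (l : M.Num) (hl : l < d + d) :
      blockEntry (matEntry X) (t + 0) (t + (1 + 1)) 0 l = signBits (l = s + s) False := by
    have := zero_le (a := l)
    have := zero_le (a := s)
    simp only [blockEntry, add_assoc]
    refine (entry_eq ?_ ?_).trans (signBits_congr ?_ ?_) <;> grind
  have column (l : M.Num) (hl : l < d + d) :
      blockEntry (matEntry X) (t + (1 + 1)) (t + 1) l 0 = signBits False (l = s + s + 1) := by
    have := zero_le (a := l)
    have := zero_le (a := s)
    simp only [blockEntry, add_assoc]
    refine (entry_eq ?_ ?_).trans (signBits_congr ?_ ?_) <;> grind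
  have middle (a b : M.Num) (ha : a < d + d) (hb : b < d + d) :
      blockEntry (matEntry X) (t + (1 + 1)) (t + (1 + 1)) a b =
        signBits (b = a + (s + s + 1 + 1)) (a = b + (s + s + 1 + 1)) := by
    simp only [blockEntry, add_assoc]
    refine (entry_eq ?_ ?_).trans (signBits_congr ?_ ?_) <;> grind
  have isIntCode (a b : M.Num) (ha : a < d + d) (hb : b < d + d) :=
    (middle a b ha hb).symm ▸ isIntCode_signBits (M := M) _ _
  simp only [blockEntry_blockEntry]
  obtain hsd | hds' := lt_or_ge s d
  · have hsd' : s + s + 1 < d + d :=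
      (add_right_comm s s 1).trans_lt (add_lt_add_of_le_of_lt (num_succ_le_iff.2 hsd) hsd)
    rw [isPBCoeff_iff_of_unit isIntCode hsd' row column fun a ha => ?_]
    · exact Eq.congr_right (signBits_congr Iff.rfl (and_iff_right hsd).symm)
    · rw [middle a _ ha ((lt_add_one _).trans hsd')]
      have := zero_le (a := a)
      apply signBits_eq_zeroBits <;> grind
  · rw [isPBCoeff_iff_of_row_zero isIntCode fun l hl => ?_]
    · rw [signBits_eq_zeroBits id fun h => hds'.not_gt h.1]
    · rw [row l hl]
      exact signBits_eq_zeroBits (hl.trans_le (add_le_add hds' hds')).ne id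

theorem isPBMatrix_iff_of_isSkewBand
    (hX : IsSkewBand (s + s + 1 + 1) (d + d + 1 + 1) (blockEntry (matEntry X) t t))
    (hds : d ≤ s + s + 1) :
    IsPBMatrix d (blockEntry (matEntry X) t t) P ↔
      ∀ i j, i < d + 1 + 1 → j < d + 1 → P i j = signBits (i = j) (s < d ∧ i = j + 1 + 1) := by
  have corner_zero : blockEntry (matEntry X) t t 0 1 = zeroBits := by
    have := zero_lt_one (α := M.Num)
    have := zero_le (a := d)
    have := zero_le (a := s)
    refine (hX _ _ ?_ ?_).trans (signBits_eq_zeroBits ?_ ?_) <;> grind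
  refine forall₄_congr fun i j _ _ => ?_
  rw [corner_zero]
  simp only [isPBCoeff_iff_of_isSkewBand hX hds]
  have lt_succ : j < j + 1 := lt_add_one j
  have lt_succ_succ : j < j + 1 + 1 := lt_succ.trans (lt_add_one _)
  have not_both : i = j → ¬ (s < d ∧ i = j + 1 + 1) := fun h h' =>
    lt_succ_succ.ne (h.symm.trans h'.2)
  constructor
  · rintro ⟨above, diagonal, below, coefficient⟩
    obtain hij | rfl | hji := lt_trichotomy i j
    · rw [above hij, signBits_eq_zeroBits hij.ne fun h => (hij.trans lt_succ_succ).ne h.2]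
    · rw [diagonal rfl, signBits_eq_oneBits rfl fun h => lt_succ_succ.ne h.2]
    obtain rfl | hji := (num_succ_le_iff.2 hji).eq_or_lt
    · rw [below rfl, signBits_eq_zeroBits lt_succ.ne' fun h => (lt_add_one _).ne h.2]
    obtain ⟨r, rfl⟩ := num_exists_add_of_le (num_succ_le_iff.2 hji)
    rw [coefficient r rfl]
    exact signBits_congr (iff_of_false id (lt_succ_succ.trans_le le_self_add).ne')
      (by rw [add_eq_left])
  · intro entry_eq
    rw [entry_eq]
    refine ⟨fun h => ?_, fun h => ?_, fun h => ?_, fun r hr => ?_⟩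
    · exact signBits_eq_zeroBits h.ne fun h' => (h.trans lt_succ_succ).ne h'.2
    · exact signBits_eq_oneBits h (not_both h)
    · exact signBits_eq_zeroBits (h.trans_ne lt_succ.ne') fun h' =>
        (lt_add_one _).ne (h.symm.trans h'.2)
    · rw [hr]
      exact signBits_congr (iff_of_false (lt_succ_succ.trans_le le_self_add).ne' id)
        (by rw [add_eq_left])

theorem isPBMatrix_iff_of_isBlockIdentity {n k : M.Num}
    (hX : IsBlockIdentity (n + n) (matEntry X)) (hkd : k + d + 1 = n + n) :
    IsPBMatrix d (blockEntry (matEntry X) (k + k) (k + k)) P ↔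
      ∀ i j, i < d + 1 + 1 → j < d + 1 → P i j = signBits (i = j) (k < n ∧ i = j + 1 + 1) := by
  obtain rfl | ⟨s, rfl⟩ := num_eq_zero_or_eq_succ n
  · exact absurd (hkd.trans (add_zero 0)) (add_pos_of_right zero_lt_one _).ne'
  have band : s + 1 + (s + 1) = s + s + 1 + 1 := by ring
  have order : s + 1 + (s + 1) + (s + 1 + (s + 1)) = k + k + (d + d + 1 + 1) := by
    rw [← hkd]
    ring
  rw [isBlockIdentity_iff, order, band] at hX
  have add_eq : k + d = s + s + 1 := add_right_cancel (hkd.trans band)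
  have lt_iff : s < d ↔ k < s + 1 := by grind
  rw [isPBMatrix_iff_of_isSkewBand (isSkewBand_blockEntry hX) (add_eq ▸ le_add_self)]
  simp only [lt_iff]

end PBMatrix

section Pfaffian
variable {M : Model.{u, v}} [IsModel M] {m n : M.Num} {X : M.Str} {z : BitSet M}

/-- The recursion for the Pfaffian coefficients of the trailing diagonal blocks of `(0, I; -I, 0)`,
with `I` of order `2 * n`. Read as a polynomial, row `k` is `1 - X ^ 2` times row `k + 1` if
`k < n`, and equal to row `k + 1` otherwise. -/
def IsCoeffArray (n : M.Num) (Q : BitMatrix M) : Prop :=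
  Q (n + n) 0 = oneBits ∧ ∀ k d, k + d + 1 = n + n → ∀ i < d + 1 + 1,
    IsDot (d + 1) (fun j => signBits (i = j) (k < n ∧ i = j + 1 + 1)) (Q (k + 1)) (Q k i)

theorem isPfaffian_iff (hX : IsBlockIdentity (n + n) (matEntry X)) :
    IsPfaffian (n + n) (matEntry X) z ↔
      ∃ Q, IsCoeffArray n (matEntry Q) ∧ matEntry Q 0 (n + n) = z := by
  simp only [IsPfaffian, IsCoeffArray, and_assoc]
  refine exists_congr fun Q => and_congr_right fun _ => and_congr_left fun _ =>
    forall₃_congr fun k d hkd => ?_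
  simp only [isPBMatrix_iff_of_isBlockIdentity hX hkd]
  have isDot_iff {P : BitMatrix M} (entry_eq : ∀ i j, i < d + 1 + 1 → j < d + 1 →
      P i j = signBits (i = j) (k < n ∧ i = j + 1 + 1)) {i : M.Num} (hi : i < d + 1 + 1) :
      IsDot (d + 1) (P i) (matEntry Q (k + 1)) (matEntry Q k i) ↔ IsDot (d + 1)
        (fun j => signBits (i = j) (k < n ∧ i = j + 1 + 1)) (matEntry Q (k + 1))
        (matEntry Q k i) :=
    isDot_congr fun j hj _ => by rw [entry_eq i j hi hj]
  constructor
  · rintro ⟨P, entry_eq, isMatProd⟩ i hi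
    exact (isDot_iff entry_eq hi).1 (isMatProd i 0 hi zero_lt_one)
  · intro isDot
    obtain ⟨P, entry_eq⟩ := exists_str_matEntry_eq
      (fun i j => signBits (i = j) (k < n ∧ i = j + 1 + 1)) (d + 1 + 1) (d + 1) (1 + 1)
      fun _ _ _ _ _ => lt_two_of_signBits
    exact ⟨P, entry_eq, fun i _ hi _ => (isDot_iff entry_eq hi).2 (isDot i hi)⟩

theorem isDot_iff_of_le {d i k : M.Num} {y : M.Num → BitSet M} (hnk : n ≤ k)
    (hy : ∀ j < d + 1, y j = signBits (j = 0) False) :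
    IsDot (d + 1) (fun j => signBits (i = j) (k < n ∧ i = j + 1 + 1)) y z ↔
      z = signBits (i = 0) False := by
  rw [isDot_unit_right (add_pos_of_right zero_lt_one d) (isIntCode_signBits _ _) hy]
  exact Eq.congr_right (signBits_congr Iff.rfl (iff_of_false (fun h => hnk.not_gt h.1) id))

theorem IsCoeffArray.eq_of_le {Q : M.Str} (h : IsCoeffArray n (matEntry Q)) {k d i : M.Num}
    (hnk : n ≤ k) (hkd : k + d = n + n) (hid : i ≤ d) :
    matEntry Q k i = signBits (i = 0) False := by
  suffices ∀ d k, k ≤ n + n → n ≤ k → k + d = n + n → ∀ i, i ≤ d →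
      matEntry Q k i = signBits (i = 0) False from
    this d k (hkd ▸ le_self_add) hnk hkd i hid
  clear! k i d
  refine num_induction (fun k _ _ hk i hi => ?_) fun d ih k _ hnk hkd i hi => ?_
  · obtain rfl := le_zero_iff.1 hi
    obtain rfl : k = n + n := (add_zero k).symm.trans hk
    exact h.1.trans (signBits_eq_oneBits rfl id).symm
  · have hkd' : k + 1 + d = n + n := by rw [← hkd]; ring
    have row_eq (j : M.Num) (hj : j < d + 1) : matEntry Q (k + 1) j = signBits (j = 0) False :=
      ih (k + 1) (hkd' ▸ le_self_add) (hnk.trans (lt_add_one k).le) hkd' j (num_lt_succ_iff.1 hj)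
    exact (isDot_iff_of_le hnk row_eq).1
      (h.2 k d ((add_assoc k d 1).trans hkd) i (num_lt_succ_iff.2 hi))

theorem isNegOnePow_succ_negBits (h : IsNegOnePow n z) : IsNegOnePow (n + 1) (negBits z) := by
  obtain ⟨⟨t, rfl⟩, rfl⟩ | ⟨⟨t, rfl⟩, rfl⟩ := h
  · exact .inr ⟨⟨t, rfl⟩, negBits_oneBits⟩
  · exact .inl ⟨⟨t + 1, by ring⟩, negBits_negOneBits⟩

instance (W : M.Str) (f g h : (ℕ → M.Num) → M.Num) [hf : TermDefinable f] [TermDefinable g]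
    [TermDefinable h] : SigmaB0Definable fun e => IsNegOnePow (f e) (matEntry W (g e) (h e)) := by
  have := hf.shift
  exact .congr (S := fun e =>
    (∃ t, t ≤ f e ∧ f e = t + t) ∧ matEntry W (g e) (h e) = oneBits ∨
      (∃ t, t ≤ f e ∧ f e = t + t + 1) ∧ matEntry W (g e) (h e) = negOneBits) inferInstance
    fun e => or_congr
      (and_congr_left fun _ => exists_congr fun t =>
        (and_iff_right_of_imp fun h => h ▸ le_self_add).symm)
      (and_congr_left fun _ => exists_congr fun t =>
        (and_iff_right_of_imp fun h => h ▸ le_self_add.trans (lt_add_one _).le).symm)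

theorem prodEq_zeroBits_of_degree_le {y : M.Num → BitSet M} [∀ l, Coded (y l)] {q c i l : M.Num}
    (tail_zero : ∀ l < q, c < l → y l = zeroBits) (hci : c + 1 + 1 ≤ i) (hlq : l < q)
    (hlc : l ≠ c) : ProdEq (signBits (i = l) (i = l + 1 + 1)) (y l) zeroBits := by
  obtain hlc | hcl := hlc.lt_or_gt
  · have hli : l + 1 + 1 < i := hci.trans_lt' (by gcongr)
    rw [signBits_eq_zeroBits ((lt_add_one l).trans ((lt_add_one _).trans hli)).ne' hli.ne']
    exact prodEq_zeroBits_left _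
  · rw [tail_zero l hlq hcl]
    exact prodEq_zeroBits_right _

theorem isDot_iff_of_degree_add_two {y : M.Num → BitSet M} [∀ l, Coded (y l)] {q c : M.Num}
    (tail_zero : ∀ l < q, c < l → y l = zeroBits) (hcq : c < q) :
    IsDot q (fun l => signBits (c + 1 + 1 = l) (c + 1 + 1 = l + 1 + 1)) y z ↔
      z = negBits (y c) := by
  refine isDot_iff_eq_of_single hcq (isIntCode_negBits _) ?_ fun l =>
    prodEq_zeroBits_of_degree_le tail_zero le_rfl
  rw [signBits_eq_negOneBits rfl]
  exact prodEq_negOneBits_left _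

theorem isDot_iff_of_degree_add_two_lt {y : M.Num → BitSet M} [∀ l, Coded (y l)] {q c i : M.Num}
    (tail_zero : ∀ l < q, c < l → y l = zeroBits) (hci : c + 1 + 1 < i) :
    IsDot q (fun l => signBits (i = l) (i = l + 1 + 1)) y z ↔ z = zeroBits := by
  refine isDot_iff_eq_zeroBits fun l hl => ?_
  obtain rfl | hlc := eq_or_ne l c
  · rw [signBits_eq_zeroBits ((lt_add_one l).trans ((lt_add_one _).trans hci)).ne' hci.ne']
    exact prodEq_zeroBits_left _
  · exact prodEq_zeroBits_of_degree_le tail_zero hci.le hl hlc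

/-- The polynomial of row `k` has degree `2 * (n - k)` and leading coefficient `(-1) ^ (n - k)`. -/
theorem IsCoeffArray.isNegOnePow_of_add_eq {Q : M.Str} (h : IsCoeffArray n (matEntry Q))
    {k c : M.Num} (hkc : k + c = n) :
    IsNegOnePow c (matEntry Q k (c + c)) ∧
      ∀ i, i ≤ n + c → c + c < i → matEntry Q k i = zeroBits := by
  suffices ∀ c k, k ≤ n → k + c = n → IsNegOnePow c (matEntry Q k (c + c)) ∧
      ∀ i, i ≤ n + c → c + c < i → matEntry Q k i = zeroBits from
    this c k (hkc ▸ le_self_add) hkc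
  clear! k c
  refine num_induction (fun k _ hk => ?_) fun c ih k _ hkc => ?_
  · obtain rfl : k = n := (add_zero k).symm.trans hk
    have entry_eq {i : M.Num} (hi : i ≤ k) := h.eq_of_le le_rfl rfl hi
    rw [add_zero, add_zero]
    refine ⟨.inl ⟨⟨0, (add_zero 0).symm⟩, ?_⟩, fun i hi hi_pos => ?_⟩
    · exact (entry_eq zero_le).trans (signBits_eq_oneBits rfl id)
    · exact (entry_eq hi).trans (signBits_eq_zeroBits hi_pos.ne' id)
  · have hkc' : k + 1 + c = n := by rw [← hkc]; ring
    have hkn : k < n := num_succ_le_iff.1 (hkc' ▸ le_self_add)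
    have hcn : c < n := num_succ_le_iff.1 (hkc ▸ le_add_self)
    have isDot := h.2 k (n + c) (by rw [← hkc]; ring)
    simp only [hkn, true_and] at isDot
    obtain ⟨leading, tail_zero⟩ := ih (k + 1) (num_succ_le_iff.2 hkn) hkc'
    replace tail_zero : ∀ i < n + c + 1, c + c < i → matEntry Q (k + 1) i = zeroBits :=
      fun i hi => tail_zero i (num_lt_succ_iff.1 hi)
    rw [show c + 1 + (c + 1) = c + c + 1 + 1 by ring, ← add_assoc n c 1]
    refine ⟨?_, fun i hi hci => ?_⟩
    · rw [(isDot_iff_of_degree_add_two tail_zero (num_lt_succ_iff.2 (by gcongr))).1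
        (isDot _ (by gcongr))]
      exact isNegOnePow_succ_negBits leading
    · exact (isDot_iff_of_degree_add_two_lt tail_zero hci).1 (isDot i (num_lt_succ_iff.2 hi))

/-- The rows of index at most `n` list the coefficients of `(1 - X ^ 2) ^ c` modulo `X ^ m`. -/
def IsOneSubSqPow (m n : M.Num) (F : BitMatrix M) : Prop :=
  (∀ i < m, F 0 i = signBits (i = 0) False) ∧ ∀ c < n, ∀ i < m,
    IsDot m (fun l => signBits (i = l) (i = l + 1 + 1)) (F c) (F (c + 1) i)

/-- They are the first rows of the powers of the matrix of multiplication by `1 - X ^ 2`. -/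
theorem exists_isOneSubSqPow (n : M.Num) (hm : 0 < m) :
    ∃ W, IsOneSubSqPow m n fun c => matsEntry W c 0 := by
  obtain ⟨A, entry_eq⟩ := exists_str_matEntry_eq
    (fun l i => (signBits (i = l) (i = l + 1 + 1) : BitSet M)) m m (1 + 1)
    fun _ _ _ _ _ => lt_two_of_signBits
  obtain ⟨-, W, isIdentity, isMatProd, -⟩ := exists_isMatPow n (X := A) fun a b ha hb =>
    entry_eq a b ha hb ▸ isIntCode_signBits _ _
  refine ⟨W, fun i hi => ?_, fun c hc i hi => ?_⟩
  · exact (eq_signBits_iff fun _ => id).2 ⟨fun h => (isIdentity 0 i hm hi).1 h.symm, False.elim,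
      fun h => (isIdentity 0 i hm hi).2 (Ne.symm h.1)⟩
  · have isMatPow : IsMatPow m (matEntry A) c (matsEntry W c) :=
      ⟨W, isIdentity, fun k hk => isMatProd k (hk.trans hc), fun _ _ _ _ => rfl⟩
    refine (isDot_congr fun l hl v => ?_).1 (isMatProd c hc 0 i hm hi)
    rw [entry_eq l i hl hi]
    obtain ⟨w, prodEq_left, prodEq_right⟩ :=
      exists_prodEq_signBits (i = l) (i = l + 1 + 1) (isMatPow.isIntCode hm hl)
    exact (prodEq_right v).trans (prodEq_left v).symm

theorem IsOneSubSqPow.eq_zeroBits {W : M.Str}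
    (h : IsOneSubSqPow m n fun c => matsEntry W c 0) {c i : M.Num} (hc : c ≤ n) (hi : i < m)
    (hci : c + c < i) : matsEntry W c 0 i = zeroBits := by
  suffices ∀ c, c ≤ n → ∀ i, i < m → c + c < i → matsEntry W c 0 i = zeroBits from
    this c hc i hi hci
  clear! c i
  refine num_induction (fun _ i hi hi_pos => ?_) fun c ih hc i hi hci => ?_
  · rw [add_zero] at hi_pos
    exact (h.1 i hi).trans (signBits_eq_zeroBits hi_pos.ne' id)
  · have hc := num_succ_le_iff.1 hc
    rw [show c + 1 + (c + 1) = c + c + 1 + 1 by ring] at hci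
    exact (isDot_iff_of_degree_add_two_lt (ih hc.le) hci).1 (h.2 c hc i hi)

theorem isCoeffArray_of_isOneSubSqPow {W Q : M.Str}
    (h : IsOneSubSqPow (n + n + 1) n fun c => matsEntry W c 0)
    (row_eq : ∀ k c, k + c = n → ∀ i < n + n + 1, matEntry Q k i = matsEntry W c 0 i)
    (row_eq_of_le : ∀ k, n ≤ k → k ≤ n + n → ∀ i < n + n + 1, matEntry Q k i = matsEntry W 0 0 i) :
    IsCoeffArray n (matEntry Q) := by
  have unit_row {k i : M.Num} (hnk : n ≤ k) (hk : k ≤ n + n) (hi : i < n + n + 1) :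
      matEntry Q k i = signBits (i = 0) False := (row_eq_of_le k hnk hk i hi).trans (h.1 i hi)
  refine ⟨(unit_row le_self_add le_rfl (add_pos_of_right zero_lt_one _)).trans
    (signBits_eq_oneBits rfl id), fun k d hkd i hi => ?_⟩
  have hk : k + 1 ≤ n + n := hkd ▸ by rw [add_right_comm]; exact le_self_add
  have hd : d + 1 ≤ n + n := hkd ▸ by rw [add_assoc]; exact le_add_self
  have hi : i < n + n + 1 := hi.trans_le (by gcongr)
  obtain hnk | hkn := le_or_gt n k
  · refine (isDot_iff_of_le hnk fun j hj => ?_).2 (unit_row hnk ((lt_add_one k).le.trans hk) hi)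
    exact unit_row (hnk.trans (lt_add_one k).le) hk (hj.trans_le (hd.trans (lt_add_one _).le))
  · obtain ⟨c, rfl⟩ := num_exists_add_of_le (num_succ_le_iff.2 hkn)
    have hcn : c < k + 1 + c  := by
      rw [add_right_comm]
      exact num_lt_succ_iff.2 le_add_self
    have hcd : c + c < d + 1 := by
      rw [add_left_cancel (a := k) (b := d + 1) (c := c + c + 1 + (k + 1))
        (by rw [← add_assoc, hkd]; ring)]
      exact (lt_add_one _).trans_le le_self_add
    simp only [hkn, true_and]
    rw [row_eq k (c + 1) (by ring) i hi, ← isDot_iff_of_tail_zero (hd.trans (lt_add_one _).le)]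
    · refine (isDot_congr fun l hl v => ?_).1 (h.2 c hcn i hi)
      rw [row_eq (k + 1) c rfl l hl]
    · intro l hdl hl
      rw [row_eq (k + 1) c rfl l hl, h.eq_zeroBits hcn.le hl (hcd.trans_le hdl)]
      exact prodEq_zeroBits_right _

theorem exists_isCoeffArray (n : M.Num) : ∃ Q, IsCoeffArray n (matEntry (M := M) Q) := by
  obtain ⟨W, hW⟩ := exists_isOneSubSqPow (m := n + n + 1) n (add_pos_of_right zero_lt_one _)
  obtain ⟨Q, entry_eq⟩ := exists_str_matEntry_eq
    (fun k i x => ∃ c, c ≤ n ∧ (k + c = n ∨ n ≤ k ∧ c = 0) ∧ matsEntry W c 0 i x)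
    (n + n + 1) (n + n + 1) (M.len W) fun _ _ _ _ _ ⟨_, _, _, h⟩ => lt_len_of_rowBits h
  have eq_zero_of_add_eq {k c : M.Num} (hkc : k + c = n) (hnk : n ≤ k) : c = 0 :=
    le_zero_iff.1 (le_of_add_le_add_left (hkc.trans_le hnk |>.trans_eq (add_zero k).symm))
  have row_eq {k c : M.Num} (hk : k ≤ n + n) (hc : c ≤ n) (hkc : k + c = n ∨ n ≤ k ∧ c = 0)
      {i : M.Num} (hi : i < n + n + 1) : matEntry Q k i = matsEntry W c 0 i := by
    rw [entry_eq k i (num_lt_succ_iff.2 hk) hi]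
    refine funext fun x => propext ⟨?_, fun h => ⟨c, hc, hkc, h⟩⟩
    rintro ⟨c', -, hkc', h⟩
    obtain rfl : c' = c := by
      obtain hkc' | ⟨hnk, rfl⟩ := hkc' <;> obtain hkc | ⟨hnk, rfl⟩ := hkc
      · exact add_left_cancel (hkc'.trans hkc.symm)
      · exact eq_zero_of_add_eq hkc' hnk
      · exact (eq_zero_of_add_eq hkc hnk).symm
      · rfl
    exact h
  exact ⟨Q, isCoeffArray_of_isOneSubSqPow hW
    (fun k c hkc i hi => row_eq (hkc ▸ le_self_add.trans le_self_add) (hkc ▸ le_add_self)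
      (.inl hkc) hi)
    fun k hnk hk i hi => row_eq hk zero_le (.inr ⟨hnk, rfl⟩) hi⟩

end Pfaffian

end VSharpL

theorem mainTheorem9 : VSharpL.Proves.{u, v} VSharpL.theory VSharpL.pfBlockIdentity := by
  rintro M hM _ rfl e E
  have : VSharpL.IsModel M := ⟨hM⟩
  rw [VSharpL.sat_pfBlockIdentity]
  refine fun n => ⟨VSharpL.exists_isBlockIdentity _, fun A hA => ⟨?_, fun Z hZ => ?_⟩⟩
  · obtain ⟨Q, hQ⟩ := VSharpL.exists_isCoeffArray n
    obtain ⟨Z, hZ⟩ := VSharpL.Coded.exists_eq (VSharpL.matEntry Q 0 (n + n))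
    exact ⟨Z, (VSharpL.isPfaffian_iff hA).2 ⟨Q, hQ, hZ⟩⟩
  · obtain ⟨Q, hQ, hZ⟩ := (VSharpL.isPfaffian_iff hA).1 hZ
    exact hZ ▸ (hQ.isNegOnePow_of_add_eq (zero_add n)).1
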